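/- \textbf{Theorem (Spacetime fault distance of the gauging measurement).} \emph{Setting.} Let $\{s_j\}_{j\in J}$ be the checks of a stabilizer code on a finite set $Q$ of qubits, with distance $d$ (the least weight of a Pauli operator that commutes with all checks and is not, up to phase, a product of checks), and let $L=\prod_{q\in\mathcal L}X_q$, $\mathcal L\subseteq Q$, be a nontrivial logical operator. Let $G$ be a finite connected simple graph whose Cheeger constant $$h(G)=\inf\Big\{\tfrac{|\partial A|}{|A|} : \emptyset\ne A\subseteq V_G,\ |A|\le \tfrac{|V_G|}{2}\Big\}$$ satisfies $h(G)\ge 1$ (with $\inf\emptyset=\infty$). Let $R\ge 0$, and let $\Gamma$ be a simple graph on $V_G\times\{0,\dots,R\}$ that contains a copy of $G$ in each layer $V_G\times\{r\}$ and the edges joining $(v,r)$ to $(v,r+1)$, and possibly further edges (for $R=0$ one may take $\Gamma=G$). Identify $\mathcal L$ injectively with vertices in layer $0$; the other vertices are dummy vertices carrying no qubit. Put a qubit on each edge of $\Gamma$. Choose a family of edge sets $p$ generating the $\mathbb Z_2$ cycle space of $\Gamma$, for each $j$ an edge set $\gamma_j$ with $\partial\gamma_j=$ the set of vertices of those qubits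 of $\mathcal L$ on which $s_j$ acts by $Y$ or $Z$, and paths in $\Gamma$ from a base vertex $v_0$ to each vertex. Let $A_v=X_v\prod_{e\ni v}X_e$ (without the factor $X_v$ if $v$ is a dummy vertex), $B_p=\prod_{e\in p}Z_e$ and $\tilde s_j=s_j\prod_{e\in\gamma_j}Z_e$. \emph{Procedure.} The input is a code state $\psi$ (as established by a perfect initial round of check measurements). Measure the checks $s_j$ for $a$ further rounds; at time $t_i$ initialize all edge qubits in $|0\rangle$; measure all $A_v,B_p,\tilde s_j$ for $T=t_o-t_i\ge 1$ rounds; at time $t_o$ measure $Z_e$ on all edge qubits and discard them; measure the $s_j$ for $b$ rounds; finally perform a perfect round of measurements of the $s_j$. The reported result $\sigma$ is the product of the reported outcomes of all $A_v$ in the first deformed round, and the byproduct operator is the product of the $X_q$, $q\in\mathcal L$, for which the reported outcomes of $Z_e$ along the chosen path from $v_0$ to the vertex of $q$ multiply to $-1$. \emph{Faults.} A spacetime fault is a collection of single-qubit Pauli errors on the qubits present at the integer times between consecutive rounds, misinitializations of edge qubits, and misreported outcomes of any measurement other than those of the two perfect rounds; its weight is the number of these errors. A detector is a collection of measurements whose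 outcomes multiply to $+1$ in every fault-free run on every code state. A spacetime logical fault is a fault under which every run on a code state still satisfies all detectors. It is a spacetime stabilizer if moreover it does not affect the result of the procedure: on every code state $\psi$ and for every record of reported outcomes that can occur, the final state after the byproduct operator is proportional to $(1+\sigma L)\psi$. The spacetime fault distance is the least weight of a spacetime logical fault that is not a spacetime stabilizer. \emph{Claim.} Suppose that $t_o-t_i\ge d$ and that there are at least $d$ rounds of the original code before and after (counting the perfect ones: $a+1\ge d$, $b+1\ge d$). Then the procedure has spacetime fault distance at least $d$. The spacetime fault distance is exactly $d$ if $t_o-t_i=d$, and also if the code has a nontrivial logical Pauli operator of weight $d$ that is not, up to phase, a product of checks or $L$ times a product of checks. -/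

import Mathlib

open scoped ENNReal

noncomputable section

namespace Gauging

/-! ### Pauli operators on qubits -/

/-- Pauli operators up to phase on the qubits `N`, as binary symplectic vectors: the value at a qubit
is the pair (exponent of `X`, exponent of `Z`), so that `(1, 1)` stands for `Y`. -/
abbrev Pauli (N : Type*) := N → ZMod 2 × ZMod 2

/-- State vectors of the qubits `N`, given by their amplitudes in the computational basis. -/
abbrev QState (N : Type*) := (N → ZMod 2) → ℂ

/-- The sign `(-1) ^ s` of a bit `s`. -/
def bitSign (s : ZMod 2) : ℂ := (-1) ^ s.val

/-- The Hermitian Pauli operator `⨂ q, i ^ (x q * z q) X ^ (x q) Z ^ (z q)` (that is, the tensor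
product of the matrices `1, X, Y, Z`), acting on state vectors, where
`X |c⟩ = |c + 1⟩` and `Z |c⟩ = (-1) ^ c |c⟩`. -/
def pauliOp {N : Type*} [Fintype N] (p : Pauli N) : Module.End ℂ (QState N) where
  toFun f c := (∏ q, Complex.I ^ ((p q).1 * (p q).2).val * bitSign ((p q).2 * (c q + (p q).1))) *
    f (fun q => c q + (p q).1)
  map_add' f g := by ext c; simp [mul_add]
  map_smul' r f := by ext c; simp [mul_left_comm]

/-- The symplectic product: `0` if the two Pauli operators commute, `1` if they anticommute. -/
def symp {N : Type*} [Fintype N] (p p' : Pauli N) : ZMod 2 :=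
  ∑ q, ((p q).1 * (p' q).2 + (p q).2 * (p' q).1)

/-- The projector onto the eigenspace of the observable `M` with eigenvalue `(-1) ^ s`. -/
def outcomeProj {N : Type*} (M : Module.End ℂ (QState N)) (s : ZMod 2) :
    Module.End ℂ (QState N) :=
  (1 / 2 : ℂ) • (1 + bitSign s • M)

/-- One round of measurements of the (pairwise commuting, so that their order is immaterial)
observables `M c`, with outcomes `(-1) ^ (o c)`. -/
def roundProj {N K : Type*} [Fintype K] (M : K → Module.End ℂ (QState N)) (o : K → ZMod 2) :
    Module.End ℂ (QState N) :=
  ((Finset.univ : Finset K).toList.map fun c => outcomeProj (M c) (o c)).prod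

/-! ### Stabilizer codes -/

/-- A stabilizer code on the qubits `Q` with checks `s j = ± pauliOp (check j)`, `j : J`. -/
structure StabilizerCode (Q J : Type*) [Fintype Q] where
  check : J → Pauli Q
  sign : J → ZMod 2
  commute : ∀ i j, symp (check i) (check j) = 0
  /-- `-1` is not a product of checks: there is a nonzero code state. -/
  consistent : ∃ ψ : QState Q, ψ ≠ 0 ∧ ∀ j, bitSign (sign j) • pauliOp (check j) ψ = ψ

namespace StabilizerCode

variable {Q J : Type*} [Fintype Q] (C : StabilizerCode Q J)

/-- The check `s j` as an operator. -/
def checkOp (j : J) : Module.End ℂ (QState Q) := bitSign (C.sign j) • pauliOp (C.check j)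

/-- Code states: the common `+1` eigenvectors of the checks. -/
def IsCodeState (ψ : QState Q) : Prop := ∀ j, C.checkOp j ψ = ψ

/-- The products of checks, up to phase. -/
def stabilizers : Submodule (ZMod 2) (Pauli Q) := Submodule.span (ZMod 2) (Set.range C.check)

/-- A nontrivial logical Pauli operator: it commutes with all checks and is not a product of
checks. -/
def IsLogical (p : Pauli Q) : Prop := (∀ j, symp p (C.check j) = 0) ∧ p ∉ C.stabilizers

/-- `d` is the distance of the code: the least weight of a nontrivial logical Pauli operator. -/
def HasDistance (d : ℕ) : Prop := IsLeast {w | ∃ p, C.IsLogical p ∧ hammingNorm p = w} d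

end StabilizerCode

/-! ### Graphs -/

/-- The Cheeger constant (edge expansion): the infimum of `|∂A| / |A|` over the nonempty vertex sets
`A` with `|A| ≤ |V| / 2`, where `∂A` is the set of edges between `A` and its complement. -/
def cheeger {V : Type*} [Fintype V] [DecidableEq V] (G : SimpleGraph V) [DecidableRel G.Adj] : ℝ≥0∞ :=
  ⨅ (A : Finset V) (_ : A.Nonempty) (_ : 2 * A.card ≤ Fintype.card V),
    ((G.interedges A Aᶜ).card : ℝ≥0∞) / (A.card : ℝ≥0∞)

/-- `Γ` is obtained from the copies `0, …, R` of `G` by joining each vertex to its copy in the next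
layer and adding any further edges (such as edges that cellulate cycles). For `R = 0` and no further
edges, `Γ` is `G` itself. -/
def IsLayered {V : Type*} {R : ℕ} (G : SimpleGraph V) (Γ : SimpleGraph (V × Fin (R + 1))) : Prop :=
  (∀ u v r, G.Adj u v → Γ.Adj (u, r) (v, r)) ∧
    ∀ v (r : Fin R), Γ.Adj (v, r.castSucc) (v, r.succ)

/-- The `ℤ/2` boundary map on sets of edges (as binary vectors) of a graph. -/
def boundary {W : Type*} [Fintype W] [DecidableEq W] (Γ : SimpleGraph W) [DecidableRel Γ.Adj] :
    (Γ.edgeSet → ZMod 2) →ₗ[ZMod 2] (W → ZMod 2) where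
  toFun x w := ∑ e : Γ.edgeSet, if w ∈ (e : Sym2 W) then x e else 0
  map_add' x y := by
    ext w
    simp only [Pi.add_apply, ← Finset.sum_add_distrib]
    exact Finset.sum_congr rfl fun e _ => by split_ifs <;> simp
  map_smul' r x := by
    ext w
    simp only [Pi.smul_apply, smul_eq_mul, RingHom.id_apply, Finset.mul_sum]
    exact Finset.sum_congr rfl fun e _ => by split_ifs <;> simp

/-! ### The gauging measurement -/

/-- The choices made in the gauging measurement of a logical operator `L = ∏ q ∈ supp, X q` of the
code `C` by means of the graph `Γ`. Vertices outside the range of `vert` are dummy vertices. -/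
structure GaugingData {Q J W : Type*} [Fintype Q] [DecidableEq Q] [Fintype W] [DecidableEq W]
    (C : StabilizerCode Q J) (Γ : SimpleGraph W) [DecidableRel Γ.Adj] (P : Type*) where
  /-- The support of `L`. -/
  supp : Finset Q
  isLogical : C.IsLogical (fun q => if q ∈ supp then (1, 0) else 0)
  /-- The vertex of a qubit in the support of `L`. -/
  vert : supp ↪ W
  /-- The chosen cycles, which generate the cycle space of the graph. -/
  cycle : P → Γ.edgeSet → ZMod 2
  span_cycle : Submodule.span (ZMod 2) (Set.range cycle) = LinearMap.ker (boundary Γ)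
  /-- The edge path by which the check `s j` is deformed: its boundary is the set of the vertices
  in the `Z`-type support of `s j`. -/
  deform : J → Γ.edgeSet → ZMod 2
  boundary_deform : ∀ j w,
    boundary Γ (deform j) w = ∑ q : supp, if vert q = w then (C.check j q).2 else 0
  /-- The base vertex. -/
  base : W
  /-- The paths from the base vertex that determine the byproduct operator. -/
  path : ∀ w, Γ.Walk base w

/-- The measurements of the procedure: `a` rounds of the checks of the original code, `T` rounds of
the checks `A_v`, `B_p`, `s̃_j` of the deformed code, the read-out of `Z_e` on the edges, `b` rounds of
the checks of the original code, and a final perfect round of these checks. -/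
inductive Meas (J W P E : Type*) (a T b : ℕ)
  | before (k : Fin a) (j : J)
  | gauss (k : Fin T) (w : W)
  | flux (k : Fin T) (p : P)
  | deformed (k : Fin T) (j : J)
  | readout (e : E)
  | after (k : Fin b) (j : J)
  | final (j : J)
  deriving DecidableEq

/-- A spacetime fault: Pauli errors on the qubits that are present at the integer times (before each
of the `a` rounds, at the times `t_i, …, t_o = t_i + T`, and after each of the `b` rounds),
misinitialized edge qubits, and misreported measurements. The final round is perfect. -/
structure Fault (Q J W P E : Type*) (a T b : ℕ) where
  before : Fin a → Pauli Q
  during : Fin (T + 1) → Pauli (Q ⊕ E)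
  after : Fin b → Pauli Q
  init : Finset E
  meas : Finset (Meas J W P E a T b)
  final_perfect : ∀ j, Meas.final j ∉ meas

/-- The number of single-qubit Pauli errors, initialization errors and measurement errors. -/
def Fault.weight {Q J W P E : Type*} [Fintype Q] [Fintype E] {a T b : ℕ}
    (F : Fault Q J W P E a T b) : ℕ :=
  ∑ k, hammingNorm (F.before k) + ∑ k, hammingNorm (F.during k) + ∑ k, hammingNorm (F.after k) +
    F.init.card + F.meas.card

/-- The fault without errors. -/
def Fault.none (Q J W P E : Type*) (a T b : ℕ) : Fault Q J W P E a T b where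
  before _ := 0
  during _ := 0
  after _ := 0
  init := ∅
  meas := ∅
  final_perfect := by simp

/-- The state `φ ⊗ |x⟩` of the qubits `Q` and the edge qubits. -/
def attachEdges {Q E : Type*} [Fintype E] (x : E → ZMod 2) (φ : QState Q) : QState (Q ⊕ E) :=
  fun c => if (fun e => c (Sum.inr e)) = x then φ (fun q => c (Sum.inl q)) else 0

/-- The partial inner product `⟨z|φ` with a basis state of the edge qubits: measuring `Z` on all edge
qubits with outcomes `(-1) ^ z` and discarding them. -/
def readEdges {Q E : Type*} (z : E → ZMod 2) (φ : QState (Q ⊕ E)) : QState Q :=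
  fun c => φ (Sum.elim c z)

namespace GaugingData

variable {Q J W P : Type*} [Fintype Q] [DecidableEq Q] [Fintype J] [DecidableEq J]
  [Fintype W] [DecidableEq W] [Fintype P] [DecidableEq P]
  {C : StabilizerCode Q J} {Γ : SimpleGraph W} [DecidableRel Γ.Adj] (D : GaugingData C Γ P)

/-- The logical operator `L = ∏ q ∈ supp, X q`. -/
def logical : Pauli Q := fun q => if q ∈ D.supp then (1, 0) else 0

/-- `A_w = X_w ∏ e ∋ w, X_e`, where the factor `X_w` is absent for a dummy vertex `w`. -/
def gaussPauli (w : W) : Pauli (Q ⊕ Γ.edgeSet) :=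
  Sum.elim (fun q => if ∃ h : q ∈ D.supp, D.vert ⟨q, h⟩ = w then (1, 0) else 0)
    (fun e => if w ∈ (e : Sym2 W) then (1, 0) else 0)

/-- `B_p = ∏ e ∈ p, Z_e`. -/
def fluxPauli (p : P) : Pauli (Q ⊕ Γ.edgeSet) := Sum.elim 0 (fun e => (0, D.cycle p e))

/-- `s̃_j = s_j ∏ e ∈ γ_j, Z_e`, without its sign. -/
def deformedPauli (j : J) : Pauli (Q ⊕ Γ.edgeSet) :=
  Sum.elim (C.check j) (fun e => (0, D.deform j e))

/-- The checks of the deformed code. -/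
def deformedCheckOp : W ⊕ P ⊕ J → Module.End ℂ (QState (Q ⊕ Γ.edgeSet))
  | Sum.inl w => pauliOp (D.gaussPauli w)
  | Sum.inr (Sum.inl p) => pauliOp (D.fluxPauli p)
  | Sum.inr (Sum.inr j) => bitSign (C.sign j) • pauliOp (D.deformedPauli j)

variable {a T b : ℕ}

/-- The (unnormalized) final state of the procedure on the input `ψ` in the presence of the fault `F`,
if `o` is the record of the *reported* outcomes (a bit `s` stands for the outcome `(-1) ^ s`). It is
`0` if and only if the record `o` cannot occur. -/
def run (F : Fault Q J W P Γ.edgeSet a T b) (o : Meas J W P Γ.edgeSet a T b → ZMod 2)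
    (ψ : QState Q) : QState Q :=
  -- the actual outcomes
  let r : Meas J W P Γ.edgeSet a T b → ZMod 2 := fun m => o m + if m ∈ F.meas then 1 else 0
  let φ₁ : QState Q := Fin.foldl a (fun φ k =>
    roundProj C.checkOp (fun j => r (Meas.before k j)) (pauliOp (F.before k) φ)) ψ
  let φ₂ : QState (Q ⊕ Γ.edgeSet) := attachEdges (fun e => if e ∈ F.init then 1 else 0) φ₁
  let φ₃ : QState (Q ⊕ Γ.edgeSet) := Fin.foldl T (fun φ k =>
    roundProj D.deformedCheckOp
      (Sum.elim (fun w => r (Meas.gauss k w))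
        (Sum.elim (fun p => r (Meas.flux k p)) (fun j => r (Meas.deformed k j))))
      (pauliOp (F.during k.castSucc) φ)) φ₂
  let φ₄ : QState Q := readEdges (fun e => r (Meas.readout e)) (pauliOp (F.during (Fin.last T)) φ₃)
  let φ₅ : QState Q := Fin.foldl b (fun φ k =>
    pauliOp (F.after k) (roundProj C.checkOp (fun j => r (Meas.after k j)) φ)) φ₄
  roundProj C.checkOp (fun j => r (Meas.final j)) φ₅

/-- The byproduct operator determined by the reported read-out of the edges: `X` acts on a qubit of
the support of `L` if the outcomes along the path from the base vertex to its vertex multiply to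
`-1`. -/
def byproduct (o : Meas J W P Γ.edgeSet a T b → ZMod 2) : Pauli Q := fun q =>
  if h : q ∈ D.supp then
    (((D.path (D.vert ⟨q, h⟩)).darts.map fun t => o (Meas.readout ⟨t.edge, t.edge_mem⟩)).sum, 0)
  else 0

/-- The reported result of the measurement of `L`: the product of the outcomes of the first
measurements of all the `A_v`. -/
def result [NeZero T] (o : Meas J W P Γ.edgeSet a T b → ZMod 2) : ZMod 2 :=
  ∑ w : W, o (Meas.gauss 0 w)

/-- The record `o` can be observed when the procedure is run with fault `F` on the input `ψ`. -/
def Possible (F : Fault Q J W P Γ.edgeSet a T b) (ψ : QState Q)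
    (o : Meas J W P Γ.edgeSet a T b → ZMod 2) : Prop := D.run F o ψ ≠ 0

/-- Detectors: collections of measurements whose outcomes multiply to `+1` in every run without
faults on a code state. (State initializations have no outcome, so they need not be listed.) -/
def IsDetector (S : Finset (Meas J W P Γ.edgeSet a T b)) : Prop :=
  ∀ ψ, C.IsCodeState ψ → ∀ o, D.Possible (Fault.none Q J W P Γ.edgeSet a T b) ψ o →
    ∑ m ∈ S, o m = 0

/-- The fault `F` violates the detector `S`. -/
def Violates (F : Fault Q J W P Γ.edgeSet a T b) (S : Finset (Meas J W P Γ.edgeSet a T b)) : Prop :=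
  ∃ ψ, C.IsCodeState ψ ∧ ∃ o, D.Possible F ψ o ∧ ∑ m ∈ S, o m ≠ 0

/-- A spacetime logical fault: a fault that violates no detector. -/
def IsLogicalFault (F : Fault Q J W P Γ.edgeSet a T b) : Prop :=
  ∀ S, D.IsDetector S → ¬ D.Violates F S

/-- A spacetime stabilizer: a spacetime logical fault that does not affect the result of the
procedure, that is, on every code state `ψ` and for every record, if the reported result is `σ` then
the final state, after the byproduct operator, is still the post-measurement state `(1 + σ L) ψ`
up to normalization and phase. -/
def IsSpacetimeStabilizer [NeZero T] (F : Fault Q J W P Γ.edgeSet a T b) : Prop :=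
  D.IsLogicalFault F ∧ ∀ ψ, C.IsCodeState ψ → ∀ o, ∃ c : ℂ,
    pauliOp (byproduct D o) (D.run F o ψ) = c • (ψ + bitSign (result o) • pauliOp D.logical ψ)

variable (a T b)

/-- The spacetime fault distance: the least weight of a spacetime logical fault that is not a
spacetime stabilizer. -/
def faultDistance [NeZero T] : ℕ∞ :=
  ⨅ (F : Fault Q J W P Γ.edgeSet a T b) (_ : D.IsLogicalFault F)
    (_ : ¬ D.IsSpacetimeStabilizer F), (F.weight : ℕ∞)

end GaugingData

end Gauging

end

/-!
The procedure is analysed by moving all Pauli errors of a fault to the end. A Pauli error before a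
round of measurements can be moved behind the round at the price of flipping the outcomes with which
it anticommutes; hence a run with the fault `F` and the reported record `o` ends, up to a factor, in
the state obtained from the run without faults and with the record `o + flips F` by applying one
Pauli operator `F.total` (`GaugingData.exists_run_eq`).

Runs without faults can be computed (`GaugingData.run_none`). The first round of the deformed code
projects `ψ ⊗ |0⟩` onto a superposition, over the sets `f` of vertices, of `X_f ψ ⊗ |δf⟩`, where `δ` is
the coboundary map and `X_f` the product of the `X_q` at the vertices of `f`. Reading out the edges
selects the two sets with a given coboundary, which are complementary as the graph is connected and
so differ by `L`. The possible records thus form a vector space, the image of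
`GaugingData.record`: they are given by the outcomes `g` of the `A_w` and a set `f` of vertices, and
the final state is `X_f (1 ± L) ψ`, with the sign of `∑ w, g w`. Since detectors are exactly the
functionals that vanish on this space, `F` is a logical fault if and only if `flips F = record g f`
for some `g`, `f` (`GaugingData.isLogicalFault_iff`), and it is then a spacetime stabilizer if and
only if `∑ w, g w = 0` and `F.total * X_f` is a product of checks and `L`
(`GaugingData.isSpacetimeStabilizer_iff`).

For the lower bound, both ways to fail this criterion are costly.

* If `F.total * X_f` is not a product of checks and `L`, then it is a logical operator, and so is its
  product with `L`. The edges of `δf` are those whose read-out is flipped, by misreporting it or by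
  an `X` error, and as the Cheeger constant is at least `1`, `δf` has at least as many edges as `X_f` or
  `X_f L` has qubits. So `F` has weight at least `|F.total| + |δf| ≥ d`
  (`GaugingData.le_weight_of_notMem`).
* If `∑ w, g w = 1`, then either every one of the `T ≥ d` rounds of the deformed code contains a
  misreported measurement, or the errors accumulated up to some round commute with all `B_p` and
  `s̃_j` and anticommute with `L`, the product of all `A_w`. Their edge part is then a coboundary and
  can be cleaned by the same expansion argument, which leaves a nontrivial logical operator
  (`GaugingData.le_weight_of_sum_eq_one`).

The bound is attained by misreporting one `A_w` in all rounds, or by a logical operator applied right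
before the read-out.
-/

noncomputable section

namespace Gauging

/-! ### Pauli operators -/

lemma bitSign_zero : bitSign 0 = 1 := by simp [bitSign]

lemma bitSign_one : bitSign 1 = -1 := by simp [bitSign, ZMod.val_one]

lemma zmod_two_cases (s : ZMod 2) : s = 0 ∨ s = 1 := by
  revert s; decide

lemma bitSign_add (s t : ZMod 2) : bitSign (s + t) = bitSign s * bitSign t := by
  rcases zmod_two_cases s with rfl | rfl <;> rcases zmod_two_cases t with rfl | rfl <;>
    simp [bitSign_zero, bitSign_one, CharTwo.add_self_eq_zero]

lemma bitSign_ne_zero (s : ZMod 2) : bitSign s ≠ 0 := by simp [bitSign]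

lemma bitSign_mul_self (s : ZMod 2) : bitSign s * bitSign s = 1 := by
  rw [← bitSign_add, CharTwo.add_self_eq_zero, bitSign_zero]

lemma bitSign_sum {ι : Type*} (s : Finset ι) (f : ι → ZMod 2) :
    bitSign (∑ i ∈ s, f i) = ∏ i ∈ s, bitSign (f i) := by
  classical
  induction s using Finset.induction_on with
  | empty => simp [bitSign_zero]
  | insert i s hi ih => rw [Finset.sum_insert hi, Finset.prod_insert hi, bitSign_add, ih]

lemma zmod_two_eq_one {s : ZMod 2} (h : s ≠ 0) : s = 1 := by
  revert h; revert s; decide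

variable {N : Type*} [Fintype N]

lemma pauliOp_apply (p : Pauli N) (f : QState N) (c : N → ZMod 2) :
    pauliOp p f c =
      (∏ q, Complex.I ^ ((p q).1 * (p q).2).val * bitSign ((p q).2 * (c q + (p q).1))) *
        f (fun q => c q + (p q).1) := rfl

/-- A Pauli operator without `Z` part permutes the basis states. -/
lemma pauliOp_apply_of_snd_eq_zero {p : Pauli N} (hp : ∀ q, (p q).2 = 0) (f : QState N)
    (c : N → ZMod 2) : pauliOp p f c = f (fun q => c q + (p q).1) := by
  simp [pauliOp_apply, hp, bitSign_zero]

lemma pauliOp_zero : pauliOp (0 : Pauli N) = 1 := by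
  ext f c
  simp [pauliOp_apply_of_snd_eq_zero]

/-- The Pauli operators form a group up to phase. -/
lemma exists_pauliOp_pauliOp (p p' : Pauli N) :
    ∃ z : ℂ, z ≠ 0 ∧ ∀ f, pauliOp p (pauliOp p' f) = z • pauliOp (p + p') f := by
  refine ⟨∏ q, (Complex.I ^ ((p q).1 * (p q).2).val * Complex.I ^ ((p' q).1 * (p' q).2).val *
    (Complex.I ^ (((p + p') q).1 * ((p + p') q).2).val)⁻¹ * bitSign ((p q).2 * (p' q).1)),
    ?_, fun f => ?_⟩
  · simp [Finset.prod_ne_zero_iff, bitSign_ne_zero]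
  · ext c
    simp only [pauliOp_apply, Pi.smul_apply, smul_eq_mul, ← mul_assoc, ← Finset.prod_mul_distrib]
    congr 1
    · refine Finset.prod_congr rfl fun q _ => ?_
      -- the `Z` exponents add, so the part of the sign that depends on `c` is the same on both sides
      have hI : Complex.I ^ (((p + p') q).1 * ((p + p') q).2).val ≠ 0 := by simp
      have hs : bitSign ((p q).2 * (c q + (p q).1)) *
            bitSign ((p' q).2 * (c q + (p q).1 + (p' q).1)) =
          bitSign ((p q).2 * (p' q).1) *
            bitSign (((p + p') q).2 * (c q + ((p + p') q).1)) := by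
        rw [← bitSign_add, ← bitSign_add]
        congr 1
        simp only [Pi.add_apply, Prod.fst_add, Prod.snd_add]
        generalize (p q).1 = x, (p q).2 = z, (p' q).1 = x', (p' q).2 = z', c q = y
        revert x z x' z' y
        decide
      calc _ = (Complex.I ^ ((p q).1 * (p q).2).val * Complex.I ^ ((p' q).1 * (p' q).2).val) *
            (bitSign ((p q).2 * (p' q).1) *
              bitSign (((p + p') q).2 * (c q + ((p + p') q).1))) := by rw [← hs]; ring
        _ = _ := by field_simp
    · congr 1
      ext q
      simp [add_assoc]

lemma pauliOp_comm (p p' : Pauli N) (f : QState N) :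
    pauliOp p (pauliOp p' f) = bitSign (symp p p') • pauliOp p' (pauliOp p f) := by
  ext c
  simp only [pauliOp_apply, Pi.smul_apply, smul_eq_mul, ← mul_assoc, ← Finset.prod_mul_distrib,
    symp, bitSign_sum]
  congr 1
  · refine Finset.prod_congr rfl fun q _ => ?_
    have hs : bitSign ((p q).2 * (c q + (p q).1)) *
          bitSign ((p' q).2 * (c q + (p q).1 + (p' q).1)) =
        bitSign ((p q).1 * (p' q).2 + (p q).2 * (p' q).1) *
          bitSign ((p' q).2 * (c q + (p' q).1)) *
          bitSign ((p q).2 * (c q + (p' q).1 + (p q).1)) := by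
      rw [← bitSign_add, ← bitSign_add, ← bitSign_add]
      congr 1
      generalize (p q).1 = x, (p q).2 = z, (p' q).1 = x', (p' q).2 = z', c q = y
      revert x z x' z' y
      decide
    linear_combination
      (Complex.I ^ ((p q).1 * (p q).2).val * Complex.I ^ ((p' q).1 * (p' q).2).val) * hs
  · congr 1
    ext q
    ring

lemma pauliOp_pauliOp_self (p : Pauli N) (f : QState N) : pauliOp p (pauliOp p f) = f := by
  ext c
  simp only [pauliOp_apply, ← mul_assoc, ← Finset.prod_mul_distrib]
  rw [Finset.prod_eq_one, one_mul]
  · congr 1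
    ext q
    rw [add_assoc, CharTwo.add_self_eq_zero, add_zero]
  · intro q _
    generalize (p q).1 = x, (p q).2 = z, c q = y
    rcases zmod_two_cases x with rfl | rfl <;> rcases zmod_two_cases z with rfl | rfl <;>
      rcases zmod_two_cases y with rfl | rfl <;>
      simp [bitSign_zero, bitSign_one, CharTwo.add_self_eq_zero, ZMod.val_one]

lemma symp_add_left (p p' r : Pauli N) : symp (p + p') r = symp p r + symp p' r := by
  simp only [symp, ← Finset.sum_add_distrib]
  exact Finset.sum_congr rfl fun q _ => by simp only [Pi.add_apply, Prod.fst_add, Prod.snd_add]; ring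

lemma symp_comm (p p' : Pauli N) : symp p p' = symp p' p :=
  Finset.sum_congr rfl fun q _ => by ring

/-- The symplectic product with a fixed Pauli operator, as a linear functional. -/
def sympLin (r : Pauli N) : Pauli N →ₗ[ZMod 2] ZMod 2 where
  toFun p := symp p r
  map_add' p p' := symp_add_left p p' r
  map_smul' c p := by
    simp only [symp, Finset.mul_sum, smul_eq_mul, RingHom.id_apply, Pi.smul_apply, Prod.smul_fst,
      Prod.smul_snd]
    exact Finset.sum_congr rfl fun q _ => by ring

@[simp] lemma sympLin_apply (p r : Pauli N) : sympLin r p = symp p r := rfl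

lemma symp_zero_left (r : Pauli N) : symp 0 r = 0 := (sympLin r).map_zero

/-- Nondegeneracy of the symplectic product: a Pauli operator outside of a subspace is detected by an
operator that commutes with the whole subspace. -/
lemma exists_symp_eq_one {U : Submodule (ZMod 2) (Pauli N)} {p : Pauli N} (hp : p ∉ U) :
    ∃ r, (∀ u ∈ U, symp r u = 0) ∧ symp r p = 1 := by
  classical
  obtain ⟨f, hf, hU⟩ := Submodule.exists_le_ker_of_notMem hp
  let r : Pauli N := fun q => (f (Pi.single q (0, 1) : Pauli N), f (Pi.single q (1, 0) : Pauli N))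
  have key : ∀ u, symp r u = f u := fun u => by
    conv_rhs => rw [← Finset.univ_sum_single u]
    rw [map_sum]
    refine Finset.sum_congr rfl fun q _ => ?_
    have : (Pi.single q (u q) : Pauli N) =
        (u q).1 • (Pi.single q (1, 0) : Pauli N) + (u q).2 • (Pi.single q (0, 1) : Pauli N) := by
      rw [← Pi.single_smul, ← Pi.single_smul, ← Pi.single_add]
      simp
    rw [this, map_add, map_smul, map_smul, smul_eq_mul, smul_eq_mul]
    ring
  refine ⟨r, fun u hu => ?_, ?_⟩
  · rw [key]; exact hU hu
  · rw [key]; exact zmod_two_eq_one hf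

/-! ### Rounds of measurements -/

lemma outcomeProj_apply {N : Type*} (M : Module.End ℂ (QState N)) (s : ZMod 2) (φ : QState N) :
    outcomeProj M s φ = (1 / 2 : ℂ) • (φ + bitSign s • M φ) := rfl

lemma outcomeProj_of_eigen {N : Type*} {M : Module.End ℂ (QState N)} {t : ZMod 2} {φ : QState N}
    (h : M φ = bitSign t • φ) (s : ZMod 2) : outcomeProj M s φ = if s = t then φ else 0 := by
  rw [outcomeProj_apply, h, smul_smul, ← bitSign_add]
  split_ifs with hst
  · rw [hst, CharTwo.add_self_eq_zero, bitSign_zero, one_smul, ← two_smul ℂ φ, smul_smul]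
    norm_num
  · have : s + t = 1 := by clear h; revert s t; decide
    rw [this, bitSign_one]
    simp

/-- A round of measurements on a common eigenvector is deterministic and does not disturb it. -/
lemma roundProj_of_eigen {N K : Type*} [Fintype K] {M : K → Module.End ℂ (QState N)}
    {t : K → ZMod 2} {φ : QState N} (h : ∀ c, M c φ = bitSign (t c) • φ) (o : K → ZMod 2) :
    roundProj M o φ = if ∀ c, o c = t c then φ else 0 := by
  have key : ∀ l : List K, (l.map fun c => outcomeProj (M c) (o c)).prod φ =
      if ∀ c ∈ l, o c = t c then φ else 0 := by
    intro l
    induction l with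
    | nil => simp
    | cons c l ih =>
      rw [List.map_cons, List.prod_cons, Module.End.mul_apply, ih]
      by_cases hl : ∀ c ∈ l, o c = t c
      · rw [if_pos hl, outcomeProj_of_eigen (h c)]
        by_cases hc : o c = t c
        · have hcl : ∀ c' ∈ c :: l, o c' = t c' := by simpa using ⟨hc, hl⟩
          rw [if_pos hc, if_pos hcl]
        · rw [if_neg hc, if_neg fun h' => hc (h' c List.mem_cons_self)]
      · rw [if_neg hl, map_zero, if_neg fun h' => hl fun c hc => h' c (List.mem_cons_of_mem _ hc)]
  simpa [roundProj] using key Finset.univ.toList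

/-- A Pauli error before a round of measurements of Pauli observables can be moved behind the round
if the outcomes are shifted by its syndrome. -/
lemma roundProj_pauliOp {K : Type*} [Fintype K] (p : K → Pauli N) (z : K → ℂ) (e : Pauli N)
    (o : K → ZMod 2) (φ : QState N) :
    roundProj (fun c => z c • pauliOp (p c)) o (pauliOp e φ) =
      pauliOp e (roundProj (fun c => z c • pauliOp (p c)) (fun c => o c + symp e (p c)) φ) := by
  have step : ∀ c φ, outcomeProj (z c • pauliOp (p c)) (o c) (pauliOp e φ) =
      pauliOp e (outcomeProj (z c • pauliOp (p c)) (o c + symp e (p c)) φ) := by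
    intro c φ
    rw [outcomeProj_apply, outcomeProj_apply, map_smul, map_add, map_smul, LinearMap.smul_apply,
      LinearMap.smul_apply, map_smul, pauliOp_comm (p c) e, symp_comm, bitSign_add]
    congr 2
    simp only [smul_smul]
    congr 1
    ring
  unfold roundProj
  generalize (Finset.univ : Finset K).toList = l
  induction l with
  | nil => simp
  | cons c l ih => simp only [List.map_cons, List.prod_cons, Module.End.mul_apply, ih, step]

/-! ### Coboundaries on graphs -/

section Graph

variable {W : Type*} [Fintype W] [DecidableEq W] (Γ : SimpleGraph W)

/-- The `ℤ/2` coboundary map: the edges between a set of vertices and its complement (as binary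
vectors). -/
def coboundary : (W → ZMod 2) →ₗ[ZMod 2] (Γ.edgeSet → ZMod 2) where
  toFun f e := ∑ w, if w ∈ (e : Sym2 W) then f w else 0
  map_add' f g := by
    ext e
    simp only [Pi.add_apply, ← Finset.sum_add_distrib]
    exact Finset.sum_congr rfl fun w _ => by split_ifs <;> simp
  map_smul' r f := by
    ext e
    simp only [Pi.smul_apply, smul_eq_mul, RingHom.id_apply, Finset.mul_sum]
    exact Finset.sum_congr rfl fun w _ => by split_ifs <;> simp

lemma coboundary_apply (f : W → ZMod 2) (e : Γ.edgeSet) :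
    coboundary Γ f e = ∑ w, if w ∈ (e : Sym2 W) then f w else 0 := rfl

lemma coboundary_mk (f : W → ZMod 2) {u v : W} (h : Γ.Adj u v) :
    coboundary Γ f ⟨s(u, v), h⟩ = f u + f v := by
  have : ∀ w, (if w ∈ s(u, v) then f w else 0) =
      (if w = u then f w else 0) + (if w = v then f w else 0) := by
    intro w
    have := h.ne
    by_cases hu : w = u
    · subst hu; simp [this]
    · simp [hu]
  rw [coboundary_apply]
  simp only [this, Finset.sum_add_distrib, Finset.sum_ite_eq', Finset.mem_univ, if_true]

lemma coboundary_const (t : ZMod 2) : coboundary Γ (fun _ => t) = 0 := by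
  ext ⟨e, he⟩
  induction e with
  | h u v => rw [coboundary_mk Γ _ he, CharTwo.add_self_eq_zero]; rfl

variable {Γ}

lemma sum_darts_coboundary (f : W → ZMod 2) {u v : W} (p : Γ.Walk u v) :
    (p.darts.map fun t => coboundary Γ f ⟨t.edge, t.edge_mem⟩).sum = f u + f v := by
  induction p with
  | nil => simp [CharTwo.add_self_eq_zero]
  | @cons u v w h p ih =>
    rw [SimpleGraph.Walk.darts_cons, List.map_cons, List.sum_cons, ih]
    have : coboundary Γ f ⟨(⟨(u, v), h⟩ : Γ.Dart).edge, (⟨(u, v), h⟩ : Γ.Dart).edge_mem⟩ =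
        f u + f v := coboundary_mk Γ f h
    rw [this]
    linear_combination (CharTwo.add_self_eq_zero (f v))

lemma eq_const_of_coboundary_eq_zero (hΓ : Γ.Preconnected) {f : W → ZMod 2}
    (hf : coboundary Γ f = 0) (u v : W) : f v = f u := by
  obtain ⟨p⟩ := hΓ u v
  have := sum_darts_coboundary f p
  simp only [hf, Pi.zero_apply, List.map_const', List.sum_replicate, smul_zero] at this
  exact (CharTwo.add_eq_zero.1 this.symm).symm

variable [DecidableRel Γ.Adj]

/-- The boundary and the coboundary map are adjoint. -/
lemma sum_coboundary_mul (f : W → ZMod 2) (x : Γ.edgeSet → ZMod 2) :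
    ∑ e, coboundary Γ f e * x e = ∑ w, f w * boundary Γ x w := by
  simp only [coboundary_apply, boundary, LinearMap.coe_mk, AddHom.coe_mk, Finset.sum_mul,
    Finset.mul_sum]
  rw [Finset.sum_comm]
  exact Finset.sum_congr rfl fun w _ => Finset.sum_congr rfl fun e _ => by split_ifs <;> simp

/-- Edge sets that meet every cycle of a generating family evenly are coboundaries. -/
lemma exists_coboundary_eq {P : Type*} {cycle : P → Γ.edgeSet → ZMod 2}
    (hc : Submodule.span (ZMod 2) (Set.range cycle) = LinearMap.ker (boundary Γ))
    {y : Γ.edgeSet → ZMod 2} (hy : ∀ p, ∑ e, y e * cycle p e = 0) :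
    ∃ f, coboundary Γ f = y := by
  by_contra h
  obtain ⟨φ, hφ, hker⟩ := Submodule.exists_le_ker_of_notMem
    (p := LinearMap.range (coboundary Γ)) (v := y) (by simpa using h)
  -- a functional that separates `y` from the coboundaries is the pairing with an edge set `x`, which
  -- is a cycle because the boundary is adjoint to the coboundary
  let x : Γ.edgeSet → ZMod 2 := fun e => φ (Pi.single e 1)
  have key : ∀ z, φ z = ∑ e, z e * x e := fun z => by
    conv_lhs => rw [← Finset.univ_sum_single z]
    rw [map_sum]
    refine Finset.sum_congr rfl fun e _ => ?_
    have : (Pi.single e (z e) : Γ.edgeSet → ZMod 2) = z e • Pi.single e 1 := by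
      rw [← Pi.single_smul]; simp
    rw [this, map_smul, smul_eq_mul]
  have hx : x ∈ Submodule.span (ZMod 2) (Set.range cycle) := by
    rw [hc, LinearMap.mem_ker]
    ext w
    have := hker ⟨Pi.single w 1, rfl⟩
    rw [LinearMap.mem_ker, key, sum_coboundary_mul] at this
    simpa [Pi.single_apply] using this
  have hle : Submodule.span (ZMod 2) (Set.range cycle) ≤
      LinearMap.ker (Fintype.linearCombination (ZMod 2) y) := by
    rw [Submodule.span_le]
    rintro _ ⟨p, rfl⟩
    simpa [Fintype.linearCombination_apply, mul_comm] using hy p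
  have := hle hx
  rw [LinearMap.mem_ker, Fintype.linearCombination_apply] at this
  exact hφ (by rw [key]; simpa [mul_comm] using this)

end Graph

section Expansion

variable {V : Type*} {R : ℕ} {G : SimpleGraph V}
  {Γ : SimpleGraph (V × Fin (R + 1))}

lemma IsLayered.preconnected (hΓ : IsLayered G Γ) (hG : G.Connected) : Γ.Preconnected := by
  have hlayer : ∀ u v r, Γ.Reachable (u, r) (v, r) := fun u v r =>
    (hG.preconnected u v).map (G' := Γ) ⟨fun w => (w, r), fun h => hΓ.1 _ _ r h⟩
  have hcol : ∀ v (r : Fin (R + 1)), Γ.Reachable (v, 0) (v, r) := by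
    intro v r
    induction r using Fin.induction with
    | zero => rfl
    | succ r ih => exact ih.trans (hΓ.2 v r).reachable
  exact fun ⟨u, r⟩ ⟨v, r'⟩ => (hcol u r).symm.trans ((hlayer u v 0).trans (hcol v r'))

variable [Fintype V] [DecidableEq V] [DecidableRel G.Adj]

lemma card_le_card_interedges (hh : 1 ≤ cheeger G) (A : Finset V)
    (hA : 2 * A.card ≤ Fintype.card V) : A.card ≤ (G.interedges A Aᶜ).card := by
  rcases A.eq_empty_or_nonempty with rfl | hne
  · simp
  have h1 : (1 : ℝ≥0∞) ≤ ((G.interedges A Aᶜ).card : ℝ≥0∞) / (A.card : ℝ≥0∞) :=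
    hh.trans ((iInf_le _ A).trans ((iInf_le _ hne).trans (iInf_le _ hA)))
  rw [ENNReal.le_div_iff_mul_le (by simp [hne.ne_empty]) (by simp), one_mul] at h1
  exact_mod_cast h1

variable [DecidableRel Γ.Adj]

lemma card_interedges_le_hammingNorm (hΓ : IsLayered G Γ) (f : V × Fin (R + 1) → ZMod 2) :
    (G.interedges {v | f (v, 0) ≠ 0} ({v | f (v, 0) ≠ 0} : Finset V)ᶜ).card ≤
      hammingNorm (coboundary Γ f) := by
  have hadj : ∀ x ∈ G.interedges {v | f (v, 0) ≠ 0} ({v | f (v, 0) ≠ 0} : Finset V)ᶜ,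
      f (x.1, 0) ≠ 0 ∧ f (x.2, 0) = 0 ∧ G.Adj x.1 x.2 := by
    rintro ⟨u, v⟩ hx
    simpa [SimpleGraph.mem_interedges_iff] using hx
  rw [← Finset.card_attach]
  refine Finset.card_le_card_of_injOn
    (fun x => ⟨s((x.1.1, 0), (x.1.2, 0)), hΓ.1 _ _ 0 (hadj x.1 x.2).2.2⟩) ?_ ?_
  · intro x _
    have h := hadj x.1 x.2
    simp [coboundary_mk, h.1, h.2.1]
  · rintro ⟨⟨u, v⟩, hx⟩ - ⟨⟨u', v'⟩, hx'⟩ - h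
    have h1 := hadj _ hx
    have h2 := hadj _ hx'
    have h := congrArg Subtype.val h
    simp only [Sym2.eq_iff, Prod.mk.injEq, and_true] at h
    simp only [Subtype.mk.injEq, Prod.mk.injEq]
    rcases h with h | ⟨h, -⟩
    · exact h
    · exact absurd h2.2.1 (h ▸ h1.1)

/-- In a graph with Cheeger constant at least `1`, a coboundary is at least as large as the bottom
layer of the vertex set or of its complement. -/
lemma exists_card_le_hammingNorm_coboundary (hh : 1 ≤ cheeger G) (hΓ : IsLayered G Γ)
    (f : V × Fin (R + 1) → ZMod 2) :
    ∃ t : ZMod 2, Finset.card {v : V | f (v, 0) + t ≠ 0} ≤ hammingNorm (coboundary Γ f) := by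
  have hcard : ∀ t : ZMod 2, 2 * Finset.card {v : V | f (v, 0) + t ≠ 0} ≤ Fintype.card V →
      Finset.card {v : V | f (v, 0) + t ≠ 0} ≤ hammingNorm (coboundary Γ f) := by
    intro t ht
    have h := card_interedges_le_hammingNorm hΓ (f + fun _ => t)
    rw [map_add, coboundary_const, add_zero] at h
    exact (card_le_card_interedges hh _ ht).trans h
  have hc : Finset.card {v : V | f (v, 0) + 0 ≠ 0} + Finset.card {v : V | f (v, 0) + 1 ≠ 0} =
      Fintype.card V := by
    have h01 : ∀ x : ZMod 2, x + 1 ≠ 0 ↔ ¬ x + 0 ≠ 0 := by decide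
    simp only [h01]
    rw [Finset.card_filter_add_card_filter_not, Finset.card_univ]
  rcases le_total (2 * Finset.card {v : V | f (v, 0) + 0 ≠ 0}) (Fintype.card V) with h | h
  · exact ⟨0, hcard 0 h⟩
  · exact ⟨1, hcard 1 (by omega)⟩

end Expansion

/-! ### States of the edge qubits -/

section Edges

variable {Q E : Type*} [Fintype E]

lemma attachEdges_smul (y : E → ZMod 2) (z : ℂ) (φ : QState Q) :
    attachEdges y (z • φ) = z • attachEdges y φ := by
  ext c
  simp [attachEdges]

lemma readEdges_smul {Q E : Type*} (y : E → ZMod 2) (z : ℂ) (φ : QState (Q ⊕ E)) :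
    readEdges y (z • φ) = z • readEdges y φ := rfl

lemma readEdges_attachEdges (z y : E → ZMod 2) (φ : QState Q) :
    readEdges z (attachEdges y φ) = if z = y then φ else 0 := by
  ext c
  simp only [readEdges, attachEdges, Sum.elim_inr, Sum.elim_inl]
  split_ifs <;> simp_all

variable [Fintype Q]

lemma pauliOp_attachEdges (p : Pauli (Q ⊕ E)) (y : E → ZMod 2) (φ : QState Q) :
    pauliOp p (attachEdges y φ) =
      (∏ e, Complex.I ^ ((p (Sum.inr e)).1 * (p (Sum.inr e)).2).val *
        bitSign ((p (Sum.inr e)).2 * y e)) •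
      attachEdges (fun e => y e + (p (Sum.inr e)).1) (pauliOp (fun q => p (Sum.inl q)) φ) := by
  ext c
  simp only [pauliOp_apply, attachEdges, Pi.smul_apply, smul_eq_mul, Fintype.prod_sum_type]
  have hiff : (fun e => c (Sum.inr e) + (p (Sum.inr e)).1) = y ↔
      (fun e => c (Sum.inr e)) = fun e => y e + (p (Sum.inr e)).1 := by
    simp only [funext_iff]
    refine forall_congr' fun e => ?_
    generalize c (Sum.inr e) = x, (p (Sum.inr e)).1 = x', y e = x''
    revert x x' x''
    decide
  by_cases h : (fun e => c (Sum.inr e) + (p (Sum.inr e)).1) = y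
  · rw [if_pos h, if_pos (hiff.1 h), ← h]
    ring
  · rw [if_neg h, if_neg (h ∘ hiff.2), mul_zero, mul_zero]

lemma exists_readEdges_pauliOp (p : Pauli (Q ⊕ E)) (y : E → ZMod 2) :
    ∃ z : ℂ, z ≠ 0 ∧ ∀ φ, readEdges y (pauliOp p φ) =
      z • pauliOp (fun q => p (Sum.inl q)) (readEdges (fun e => y e + (p (Sum.inr e)).1) φ) := by
  refine ⟨∏ e, Complex.I ^ ((p (Sum.inr e)).1 * (p (Sum.inr e)).2).val *
        bitSign ((p (Sum.inr e)).2 * (y e + (p (Sum.inr e)).1)), ?_, fun φ => ?_⟩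
  · simp [Finset.prod_ne_zero_iff, bitSign_ne_zero]
  · ext c
    simp only [pauliOp_apply, readEdges, Pi.smul_apply, smul_eq_mul, Fintype.prod_sum_type,
      Sum.elim_inl, Sum.elim_inr]
    have : (fun q => Sum.elim c y q + (p q).1) =
        Sum.elim (fun q => c q + (p (Sum.inl q)).1) (fun e => y e + (p (Sum.inr e)).1) := by
      ext (q | e) <;> rfl
    rw [this]
    ring

end Edges

lemma symp_sum {Q E : Type*} [Fintype Q] [Fintype E] (p p' : Pauli (Q ⊕ E)) :
    symp p p' = symp (fun q => p (Sum.inl q)) (fun q => p' (Sum.inl q)) +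
      ∑ e, ((p (Sum.inr e)).1 * (p' (Sum.inr e)).2 + (p (Sum.inr e)).2 * (p' (Sum.inr e)).1) :=
  Fintype.sum_sum_type _

lemma pauliOp_pauliOp_of_snd_eq_zero {N : Type*} [Fintype N] {p p' : Pauli N}
    (hp : ∀ q, (p q).2 = 0) (hp' : ∀ q, (p' q).2 = 0) (f : QState N) :
    pauliOp p (pauliOp p' f) = pauliOp (p + p') f := by
  ext c
  have h : ∀ q, ((p + p') q).2 = 0 := fun q => by simp [hp, hp']
  simp only [pauliOp_apply_of_snd_eq_zero hp, pauliOp_apply_of_snd_eq_zero hp',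
    pauliOp_apply_of_snd_eq_zero h]
  simp [add_assoc]

/-- Orthogonality of the characters of `(ℤ/2) ^ W`. -/
lemma sum_bitSign {W : Type*} [Fintype W] [DecidableEq W] (f : W → ZMod 2) :
    ∑ g : W → ZMod 2, bitSign (∑ w, g w * f w) = if f = 0 then 2 ^ Fintype.card W else 0 := by
  have hs : ∀ s : ZMod 2, ∑ t : ZMod 2, bitSign (t * s) = 1 + bitSign s := by
    intro s
    have : (Finset.univ : Finset (ZMod 2)) = {0, 1} := rfl
    rw [this, Finset.sum_pair (by decide), zero_mul, one_mul, bitSign_zero]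
  simp only [bitSign_sum]
  have h := Finset.prod_univ_sum (fun _ : W => (Finset.univ : Finset (ZMod 2)))
    (fun w t => bitSign (t * f w))
  rw [Fintype.piFinset_univ] at h
  rw [← h]
  simp only [hs]
  split_ifs with hf
  · subst hf
    simp [bitSign_zero]
    norm_num
  · obtain ⟨w, hw⟩ := Function.ne_iff.1 hf
    refine Finset.prod_eq_zero (Finset.mem_univ w) ?_
    rw [zmod_two_eq_one hw, bitSign_one]
    norm_num

/-! ### Code states -/

section Code

variable {Q J : Type*} [Fintype Q] {C : StabilizerCode Q J}

lemma StabilizerCode.IsCodeState.check {ψ : QState Q} (hψ : C.IsCodeState ψ) (j : J) :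
    pauliOp (C.check j) ψ = bitSign (C.sign j) • ψ := by
  have h : bitSign (C.sign j) • pauliOp (C.check j) ψ = ψ := hψ j
  conv_rhs => rw [← h, smul_smul, bitSign_mul_self, one_smul]

lemma StabilizerCode.IsCodeState.checkOp_pauliOp {ψ : QState Q} (hψ : C.IsCodeState ψ)
    (p : Pauli Q) (j : J) :
    C.checkOp j (pauliOp p ψ) = bitSign (symp p (C.check j)) • pauliOp p ψ := by
  rw [checkOp, LinearMap.smul_apply, pauliOp_comm, hψ.check, map_smul, smul_smul, smul_smul,
    symp_comm, mul_right_comm, bitSign_mul_self, one_mul]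

lemma StabilizerCode.IsCodeState.pauliOp {ψ : QState Q} (hψ : C.IsCodeState ψ)
    {p : Pauli Q} (hp : ∀ j, symp p (C.check j) = 0) : C.IsCodeState (pauliOp p ψ) := fun j => by
  rw [hψ.checkOp_pauliOp, hp, bitSign_zero, one_smul]

lemma StabilizerCode.IsCodeState.add_smul {ψ φ : QState Q} (hψ : C.IsCodeState ψ)
    (hφ : C.IsCodeState φ) (z : ℂ) : C.IsCodeState (ψ + z • φ) := fun j => by
  rw [map_add, map_smul, hψ j, hφ j]

/-- Code states are eigenvectors of the products of checks. -/
lemma StabilizerCode.IsCodeState.exists_pauliOp_eq_smul {p : Pauli Q} (hp : p ∈ C.stabilizers) :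
    ∃ z : ℂ, ∀ ψ, C.IsCodeState ψ → Gauging.pauliOp p ψ = z • ψ := by
  induction hp using Submodule.span_induction with
  | mem p hp =>
    obtain ⟨j, rfl⟩ := hp
    exact ⟨_, fun ψ hψ => hψ.check j⟩
  | zero => exact ⟨1, fun ψ _ => by simp [pauliOp_zero]⟩
  | add p p' _ _ h h' =>
    obtain ⟨z, hz⟩ := h
    obtain ⟨z', hz'⟩ := h'
    obtain ⟨y, hy, hyp⟩ := exists_pauliOp_pauliOp p p'
    refine ⟨y⁻¹ * (z' * z), fun ψ hψ => ?_⟩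
    rw [eq_comm, mul_smul, inv_smul_eq_iff₀ hy, ← hyp, hz' ψ hψ, map_smul, hz ψ hψ, smul_smul]
  | smul c p _ h =>
    rcases zmod_two_cases c with rfl | rfl
    · exact ⟨1, fun ψ _ => by simp [pauliOp_zero]⟩
    · simpa using h

lemma StabilizerCode.symp_eq_zero_of_mem {p : Pauli Q} (hp : ∀ j, symp p (C.check j) = 0)
    {s : Pauli Q} (hs : s ∈ C.stabilizers) : symp p s = 0 := by
  have hle : C.stabilizers ≤ LinearMap.ker (sympLin p) := by
    rw [stabilizers, Submodule.span_le]
    rintro _ ⟨j, rfl⟩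
    simpa [symp_comm] using hp j
  simpa [symp_comm] using hle hs

end Code

namespace GaugingData

variable {Q J W P : Type*} [Fintype Q] [DecidableEq Q] [Fintype W] [DecidableEq W]
  {C : StabilizerCode Q J} {Γ : SimpleGraph W} [DecidableRel Γ.Adj] (D : GaugingData C Γ P)

/-! ### Products of the operators `A_w` -/

/-- The part of `∏ w, A_w ^ (f w)` on the original qubits: the product of the `X_q` over the qubits
`q` in the support of `L` at the vertices of the set `f`. -/
def vertexX : (W → ZMod 2) →ₗ[ZMod 2] Pauli Q where
  toFun f q := if h : q ∈ D.supp then (f (D.vert ⟨q, h⟩), 0) else 0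
  map_add' f g := by
    ext q <;> by_cases h : q ∈ D.supp <;> simp [h]
  map_smul' r f := by
    ext q <;> by_cases h : q ∈ D.supp <;> simp [h]

lemma vertexX_apply (f : W → ZMod 2) (q : Q) :
    D.vertexX f q = if h : q ∈ D.supp then (f (D.vert ⟨q, h⟩), 0) else 0 := rfl

lemma vertexX_snd (f : W → ZMod 2) (q : Q) : (D.vertexX f q).2 = 0 := by
  rw [vertexX_apply]
  split_ifs <;> rfl

lemma vertexX_const (t : ZMod 2) : D.vertexX (fun _ => t) = t • D.logical := by
  ext q <;> by_cases h : q ∈ D.supp <;> simp [vertexX_apply, logical, h]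

lemma symp_vertexX (f : W → ZMod 2) (p : Pauli Q) :
    symp (D.vertexX f) p = ∑ q : D.supp, f (D.vert q) * (p q).2 := by
  have h : ∀ q, (D.vertexX f q).1 * (p q).2 + (D.vertexX f q).2 * (p q).1 =
      (D.vertexX f q).1 * (p q).2 := fun q => by rw [vertexX_snd]; ring
  simp only [symp, h]
  rw [← Finset.sum_subset (Finset.subset_univ D.supp) fun q _ hq => by simp [vertexX_apply, hq],
    ← Finset.sum_coe_sort]
  exact Finset.sum_congr rfl fun q _ => by simp [vertexX_apply]

lemma symp_vertexX_check (f : W → ZMod 2) (j : J) :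
    symp (D.vertexX f) (C.check j) = ∑ e, coboundary Γ f e * D.deform j e := by
  simp only [sum_coboundary_mul, D.boundary_deform, Finset.mul_sum, symp_vertexX]
  rw [Finset.sum_comm]
  exact Finset.sum_congr rfl fun q _ => by simp

lemma sum_coboundary_mul_cycle (f : W → ZMod 2) (p : P) :
    ∑ e, coboundary Γ f e * D.cycle p e = 0 := by
  have h : D.cycle p ∈ LinearMap.ker (boundary Γ) :=
    D.span_cycle ▸ Submodule.subset_span ⟨p, rfl⟩
  rw [LinearMap.mem_ker] at h
  simp [sum_coboundary_mul, h]

lemma gaussPauli_inl (w : W) (q : Q) :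
    D.gaussPauli w (Sum.inl q) = D.vertexX (Pi.single w 1) q := by
  by_cases h : q ∈ D.supp <;> simp [gaussPauli, vertexX_apply, h, Pi.single_apply]
  split_ifs <;> rfl

lemma gaussPauli_inr (w : W) (e : Γ.edgeSet) :
    D.gaussPauli w (Sum.inr e) = (coboundary Γ (Pi.single w 1) e, 0) := by
  have : ∀ w', (if w' ∈ (e : Sym2 W) then (Pi.single w 1 : W → ZMod 2) w' else 0) =
      if w' = w then (if w ∈ (e : Sym2 W) then 1 else 0) else 0 := by
    intro w'
    by_cases h : w' = w
    · subst h; simp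
    · simp [h]
  simp only [gaussPauli, Sum.elim_inr, coboundary_apply, this]
  simp
  split_ifs <;> rfl

/-! ### The deformed code on initialized edge qubits -/

/-- The common eigenvector of the checks of the deformed code with eigenvalues `(-1) ^ (g w)` of the
`A_w` that is obtained from the code state `ψ`: up to a factor, the projection of `ψ ⊗ |0⟩`. -/
def gaugeState (g : W → ZMod 2) (ψ : QState Q) : QState (Q ⊕ Γ.edgeSet) :=
  ∑ f : W → ZMod 2,
    bitSign (∑ w, g w * f w) • attachEdges (coboundary Γ f) (pauliOp (D.vertexX f) ψ)

lemma pauliOp_gaussPauli_attachEdges (w : W) (f : W → ZMod 2) (ψ : QState Q) :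
    pauliOp (D.gaussPauli w) (attachEdges (coboundary Γ f) (pauliOp (D.vertexX f) ψ)) =
      attachEdges (coboundary Γ (f + Pi.single w 1))
        (pauliOp (D.vertexX (f + Pi.single w 1)) ψ) := by
  rw [pauliOp_attachEdges]
  simp only [gaussPauli_inr, gaussPauli_inl, mul_zero, zero_mul, bitSign_zero, ZMod.val_zero,
    pow_zero, mul_one, Finset.prod_const_one, one_smul]
  rw [show (fun q => D.vertexX (Pi.single w 1) q) = D.vertexX (Pi.single w 1) from rfl,
    pauliOp_pauliOp_of_snd_eq_zero (D.vertexX_snd _) (D.vertexX_snd _), ← map_add,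
    add_comm (Pi.single w 1) f, map_add (coboundary Γ)]
  rfl

lemma deformedCheckOp_gaugeState (g : W → ZMod 2) {ψ : QState Q} (hψ : C.IsCodeState ψ)
    (c : W ⊕ P ⊕ J) :
    D.deformedCheckOp c (D.gaugeState g ψ) =
      bitSign (Sum.elim g 0 c) • D.gaugeState g ψ := by
  rcases c with w | p | j
  · simp only [deformedCheckOp, gaugeState, map_sum, map_smul, Sum.elim_inl, Finset.smul_sum,
      pauliOp_gaussPauli_attachEdges]
    refine Fintype.sum_equiv (Equiv.addRight (Pi.single w 1)) _ _ fun f => ?_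
    rw [Equiv.coe_addRight, smul_smul, ← bitSign_add]
    congr 2
    simp only [Pi.add_apply, mul_add, Finset.sum_add_distrib, Pi.single_apply, mul_ite, mul_one,
      mul_zero, Finset.sum_ite_eq', Finset.mem_univ, if_true]
    rw [add_comm, add_assoc, CharTwo.add_self_eq_zero, add_zero]
  · simp only [deformedCheckOp, gaugeState, map_sum, map_smul, Sum.elim_inr, Pi.zero_apply,
      bitSign_zero, one_smul]
    refine Finset.sum_congr rfl fun f _ => ?_
    rw [pauliOp_attachEdges]
    have h0 : (fun q => D.fluxPauli p (Sum.inl q)) = (0 : Pauli Q) := rfl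
    simp only [h0, pauliOp_zero]
    simp only [fluxPauli, Sum.elim_inr, zero_mul, ZMod.val_zero, pow_zero, one_mul, add_zero,
      Module.End.one_apply]
    rw [← bitSign_sum]
    simp only [mul_comm (D.cycle p _), sum_coboundary_mul_cycle, bitSign_zero, one_smul]
  · simp only [deformedCheckOp, gaugeState, map_sum, map_smul, Sum.elim_inr, Pi.zero_apply,
      bitSign_zero, one_smul, LinearMap.smul_apply]
    refine Finset.sum_congr rfl fun f _ => ?_
    rw [pauliOp_attachEdges]
    have h0 : (fun q => D.deformedPauli j (Sum.inl q)) = C.check j := rfl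
    have h1 : pauliOp (C.check j) (pauliOp (D.vertexX f) ψ) =
        (bitSign (C.sign j) * bitSign (symp (D.vertexX f) (C.check j))) •
          pauliOp (D.vertexX f) ψ := by
      rw [pauliOp_comm, hψ.check, map_smul, smul_smul, symp_comm, mul_comm]
    simp only [h0, h1, attachEdges_smul]
    simp only [deformedPauli, Sum.elim_inr, zero_mul, ZMod.val_zero, pow_zero, one_mul, add_zero]
    rw [← bitSign_sum, symp_vertexX_check]
    simp only [mul_comm (D.deform j _), smul_smul]
    congr 1
    linear_combination (norm := ring_nf) (bitSign (∑ w, g w * f w)) * (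
      bitSign (∑ e, coboundary Γ f e * D.deform j e) *
      bitSign (∑ e, coboundary Γ f e * D.deform j e) * bitSign_mul_self (C.sign j) +
       bitSign_mul_self (∑ e, coboundary Γ f e * D.deform j e))

/-- The decomposition of `ψ ⊗ |0⟩` into common eigenvectors of the `A_w`. -/
lemma attachEdges_zero_eq_sum (ψ : QState Q) :
    attachEdges (0 : Γ.edgeSet → ZMod 2) ψ =
      ((2 : ℂ) ^ Fintype.card W)⁻¹ • ∑ g, D.gaugeState g ψ := by
  rw [eq_comm, inv_smul_eq_iff₀ (by simp)]
  simp only [gaugeState]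
  rw [Finset.sum_comm]
  simp only [← Finset.sum_smul, sum_bitSign, ite_smul, zero_smul]
  simp [pauliOp_zero]

variable [Fintype J] [Fintype P] in
/-- The first round of measurements of the deformed code. -/
lemma roundProj_attachEdges {ψ : QState Q} (hψ : C.IsCodeState ψ) (o : W ⊕ P ⊕ J → ZMod 2) :
    roundProj D.deformedCheckOp o (attachEdges 0 ψ) =
      if ∀ x, o (Sum.inr x) = 0 then
        ((2 : ℂ) ^ Fintype.card W)⁻¹ • D.gaugeState (fun w => o (Sum.inl w)) ψ else 0 := by
  rw [D.attachEdges_zero_eq_sum, map_smul, map_sum]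
  simp only [roundProj_of_eigen (D.deformedCheckOp_gaugeState _ hψ)]
  split_ifs with h
  · congr 1
    rw [Finset.sum_eq_single fun w => o (Sum.inl w)]
    · rw [if_pos]
      rintro (w | x)
      · rfl
      · exact h x
    · intro g _ hg
      rw [if_neg]
      exact fun h' => hg (funext fun w => (h' (Sum.inl w)).symm)
    · simp
  · rw [Finset.sum_eq_zero, smul_zero]
    intro g _
    rw [if_neg]
    exact fun h' => h fun x => h' (Sum.inr x)

lemma readEdges_gaugeState (z : Γ.edgeSet → ZMod 2) (g : W → ZMod 2) (ψ : QState Q) :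
    readEdges z (D.gaugeState g ψ) =
      ∑ f : W → ZMod 2, if z = coboundary Γ f then
        bitSign (∑ w, g w * f w) • pauliOp (D.vertexX f) ψ else 0 := by
  have h : ∀ s : Finset (W → ZMod 2), ∀ F : (W → ZMod 2) → QState (Q ⊕ Γ.edgeSet),
      readEdges z (∑ f ∈ s, F f) = ∑ f ∈ s, readEdges z (F f) := by
    intro s F
    ext c
    simp [readEdges]
  rw [gaugeState, h]
  refine Finset.sum_congr rfl fun f _ => ?_
  rw [readEdges_smul, readEdges_attachEdges, smul_ite, smul_zero]

/-- Reading out the edge qubits projects onto an eigenspace of `L`, because the coboundary determines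
a set of vertices of a connected graph up to its complement. -/
lemma readEdges_gaugeState_coboundary [Nonempty W] (hΓ : Γ.Preconnected) (f g : W → ZMod 2)
    (ψ : QState Q) :
    readEdges (coboundary Γ f) (D.gaugeState g ψ) =
      bitSign (∑ w, g w * f w) •
        pauliOp (D.vertexX f) (ψ + bitSign (∑ w, g w) • pauliOp D.logical ψ) := by
  have hne : f ≠ f + fun _ => 1 := by
    intro h
    have := congrFun h (Classical.arbitrary W)
    simp at this
  have hone : D.vertexX (fun _ => 1) = D.logical := by rw [vertexX_const, one_smul]
  rw [readEdges_gaugeState, ← Finset.sum_subset (Finset.subset_univ {f, f + fun _ => 1}),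
    Finset.sum_pair hne, if_pos rfl, if_pos (by rw [map_add, coboundary_const, add_zero]), map_add,
    map_add, map_smul, ← pauliOp_pauliOp_of_snd_eq_zero (D.vertexX_snd _) (D.vertexX_snd _), hone,
    smul_add, smul_smul, ← bitSign_add]
  · simp [mul_add, Finset.sum_add_distrib]
  · intro f' _ hf'
    rw [if_neg]
    intro h
    have h0 : coboundary Γ (f' + f) = 0 := by rw [map_add, h, ZModModule.add_self]
    have hc := eq_const_of_coboundary_eq_zero hΓ h0 (Classical.arbitrary W)
    refine hf' (Finset.mem_insert.2 ?_)
    rw [Finset.mem_singleton]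
    have hf : ∀ t, (f' + f) (Classical.arbitrary W) = t → f' = f + fun _ => t := by
      rintro t rfl
      ext w
      simp only [Pi.add_apply] at hc ⊢
      rw [← hc w, add_comm, add_assoc, CharTwo.add_self_eq_zero, add_zero]
    rcases zmod_two_cases ((f' + f) (Classical.arbitrary W)) with h' | h'
    · exact Or.inl ((hf _ h').trans (add_zero f))
    · exact Or.inr (hf _ h')

end GaugingData

namespace GaugingData

variable {Q J W P : Type*} [Fintype Q] [DecidableEq Q] [Fintype W] [DecidableEq W]
  {C : StabilizerCode Q J} {Γ : SimpleGraph W} [DecidableRel Γ.Adj] (D : GaugingData C Γ P)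
  {a T b : ℕ}

/-! ### Records of runs without faults -/

/-- The record of a run without faults in which the `A_w` have the outcomes `g` and the read-out of
the edge qubits is the coboundary of `f`. -/
def record : (W → ZMod 2) × (W → ZMod 2) →ₗ[ZMod 2] (Meas J W P Γ.edgeSet a T b → ZMod 2) where
  toFun x
    | .before _ _ => 0
    | .gauss _ w => x.1 w
    | .flux _ _ => 0
    | .deformed _ _ => 0
    | .readout e => coboundary Γ x.2 e
    | .after _ j => symp (D.vertexX x.2) (C.check j)
    | .final j => symp (D.vertexX x.2) (C.check j)
  map_add' x y := by
    ext m
    cases m <;> simp [symp_add_left]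
  map_smul' r x := by
    ext m
    have h : ∀ j, symp (r • D.vertexX x.2) (C.check j) = r * symp (D.vertexX x.2) (C.check j) :=
      fun j => (sympLin (C.check j)).map_smul r _
    cases m <;> simp [h]

/-- A sequence of steps each of which either fixes the state or annihilates it. -/
lemma foldl_of_fixed {S : Type*} [Zero S] {n : ℕ} {step : S → Fin n → S} {c : Fin n → Prop}
    [DecidablePred c] {φ : S} (h0 : ∀ k, step 0 k = 0) (h : ∀ k, step φ k = if c k then φ else 0) :
    Fin.foldl n step φ = if ∀ k, c k then φ else 0 := by
  induction n with
  | zero => simp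
  | succ n ih =>
    rw [Fin.foldl_succ_last, ih (fun k => h0 _) (fun k => h _)]
    by_cases hl : c (Fin.last n)
    · by_cases hk : ∀ k : Fin n, c k.castSucc
      · rw [if_pos hk, h, if_pos hl, if_pos (Fin.lastCases hl hk)]
      · rw [if_neg hk, h0, if_neg fun h' => hk fun k => h' _]
    · rw [if_neg fun h' : ∀ k, c k => hl (h' _)]
      split_ifs
      · rw [h, if_neg hl]
      · rw [h0]

lemma isCodeState_add_logical {ψ : QState Q} (hψ : C.IsCodeState ψ) (z : ℂ) :
    C.IsCodeState (ψ + z • pauliOp D.logical ψ) :=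
  hψ.add_smul (hψ.pauliOp D.isLogical.1) z

/-- The final state of a run without faults, up to a factor. -/
def idealState (g f : W → ZMod 2) (ψ : QState Q) : QState Q :=
  pauliOp (D.vertexX f) (ψ + bitSign (∑ w, g w) • pauliOp D.logical ψ)

variable [Fintype J] [DecidableEq J] [Fintype P] [DecidableEq P]

lemma foldl_zero {S : Type*} [Zero S] {n : ℕ} {step : S → Fin n → S} (h0 : ∀ k, step 0 k = 0) :
    Fin.foldl n step 0 = 0 := by
  simpa using foldl_of_fixed (c := fun _ => True) (φ := 0) h0 (by simpa using h0)

omit [DecidableEq Q] [DecidableEq J] [Fintype P] [DecidableEq P] in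
lemma foldl_roundProj_pauliOp {ψ : QState Q} (hψ : C.IsCodeState ψ) (p : Pauli Q) {n : ℕ}
    (o : Fin n → J → ZMod 2) :
    Fin.foldl n (fun φ k => roundProj C.checkOp (o k) φ) (pauliOp p ψ) =
      if ∀ k j, o k j = symp p (C.check j) then pauliOp p ψ else 0 :=
  foldl_of_fixed (fun _ => map_zero _)
    fun k => roundProj_of_eigen (hψ.checkOp_pauliOp p) (o k)

omit [DecidableEq J] [DecidableEq P] in
lemma foldl_roundProj_attachEdges {ψ : QState Q} (hψ : C.IsCodeState ψ) {n : ℕ}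
    (o : Fin (n + 1) → W ⊕ P ⊕ J → ZMod 2) :
    Fin.foldl (n + 1) (fun φ k => roundProj D.deformedCheckOp (o k) φ) (attachEdges 0 ψ) =
      if ∀ k x, o k x = Sum.elim (fun w => o 0 (Sum.inl w)) 0 x then
        ((2 : ℂ) ^ Fintype.card W)⁻¹ • D.gaugeState (fun w => o 0 (Sum.inl w)) ψ else 0 := by
  rw [Fin.foldl_succ, D.roundProj_attachEdges hψ]
  by_cases h : ∀ x, o 0 (Sum.inr x) = 0
  · have hstep : ∀ k : Fin n, roundProj D.deformedCheckOp (o k.succ)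
        (((2 : ℂ) ^ Fintype.card W)⁻¹ • D.gaugeState (fun w => o 0 (Sum.inl w)) ψ) =
        if ∀ x, o k.succ x = Sum.elim (fun w => o 0 (Sum.inl w)) 0 x then
          ((2 : ℂ) ^ Fintype.card W)⁻¹ • D.gaugeState (fun w => o 0 (Sum.inl w)) ψ else 0 := by
      intro k
      refine roundProj_of_eigen (fun c => ?_) _
      rw [map_smul, D.deformedCheckOp_gaugeState _ hψ, smul_comm]
    rw [if_pos h, foldl_of_fixed (fun k => map_zero _) hstep]
    refine if_congr ⟨fun h' => Fin.cases ?_ h', fun h' k => h' _⟩ rfl rfl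
    rintro (w | x)
    · rfl
    · exact h x
  · rw [if_neg h, foldl_zero fun k => map_zero _, if_neg fun h' => h fun x => h' 0 (Sum.inr x)]

/-- A run without faults can only produce the outcomes `record g f`, and its final state is then
`∏ X_q (1 ± L) ψ`. -/
lemma run_none [NeZero T] (hΓ : Γ.Preconnected) {ψ : QState Q}
    (hψ : C.IsCodeState ψ) (o : Meas J W P Γ.edgeSet a T b → ZMod 2) :
    (∃ g f, o = D.record (g, f) ∧ ∃ z : ℂ, z ≠ 0 ∧
      D.run (Fault.none Q J W P Γ.edgeSet a T b) o ψ = z • D.idealState g f ψ) ∨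
    (o ∉ LinearMap.range (D.record (a := a) (T := T) (b := b)) ∧
      D.run (Fault.none Q J W P Γ.edgeSet a T b) o ψ = 0) := by
  obtain ⟨n, rfl⟩ : ∃ n, T = n + 1 := Nat.exists_eq_succ_of_ne_zero (NeZero.ne T)
  have : Nonempty W := ⟨D.base⟩
  have hS1 : Fin.foldl a (fun φ k => roundProj C.checkOp (fun j => o (Meas.before k j)) φ) ψ =
      if ∀ k j, o (Meas.before k j) = 0 then ψ else 0 := by
    simpa [pauliOp_zero, symp_zero_left] using
      foldl_roundProj_pauliOp hψ 0 fun k j => o (Meas.before k j)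
  have hS2 := D.foldl_roundProj_attachEdges hψ fun k => Sum.elim (fun w => o (Meas.gauss k w))
    (Sum.elim (fun p => o (Meas.flux k p)) fun j => o (Meas.deformed k j))
  have h0 : (fun _ : Γ.edgeSet => (0 : ZMod 2)) = 0 := rfl
  have hatt : attachEdges (0 : Γ.edgeSet → ZMod 2) (0 : QState Q) = 0 := by
    ext c; simp [attachEdges]
  have htail : roundProj C.checkOp (fun j => o (Meas.final j))
      (Fin.foldl b (fun φ k => roundProj C.checkOp (fun j => o (Meas.after k j)) φ) 0) = 0 := by
    rw [foldl_zero fun k => map_zero _, map_zero]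
  have hread : ∀ z, readEdges z (0 : QState (Q ⊕ Γ.edgeSet)) = 0 := fun z => rfl
  simp only [run, Fault.none, Finset.notMem_empty, if_false, add_zero, pauliOp_zero,
    Module.End.one_apply, h0, hS1]
  by_cases hb : ∀ k j, o (Meas.before k j) = 0
  swap
  · refine Or.inr ⟨?_, ?_⟩
    · rintro ⟨x, rfl⟩
      exact hb fun _ _ => rfl
    · rw [if_neg hb, hatt, foldl_zero fun k => map_zero _, hread, htail]
  rw [if_pos hb, hS2]
  split_ifs with hd
  swap
  · refine Or.inr ⟨?_, by rw [hread, htail]⟩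
    rintro ⟨x, rfl⟩
    exact hd fun k c => by rcases c with w | p | j <;> rfl
  rw [readEdges_smul]
  simp only [Sum.elim_inl]
  by_cases hz : ∃ f, coboundary Γ f = fun e => o (Meas.readout e)
  swap
  · refine Or.inr ⟨?_, ?_⟩
    · rintro ⟨x, rfl⟩
      exact hz ⟨x.2, rfl⟩
    · rw [readEdges_gaugeState, Finset.sum_eq_zero, smul_zero, htail]
      exact fun f _ => if_neg fun h => hz ⟨f, h.symm⟩
  obtain ⟨f, hf⟩ := hz
  set g : W → ZMod 2 := fun w => o (Meas.gauss 0 w) with hg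
  obtain ⟨z, hz, hread'⟩ : ∃ z : ℂ, z ≠ 0 ∧ ((2 : ℂ) ^ Fintype.card W)⁻¹ •
      readEdges (fun e => o (Meas.readout e)) (D.gaugeState g ψ) = pauliOp (D.vertexX f)
        (z • (ψ + bitSign (∑ w, g w) • pauliOp D.logical ψ)) := by
    refine ⟨((2 : ℂ) ^ Fintype.card W)⁻¹ * bitSign (∑ w, g w * f w),
      by simp [bitSign_ne_zero], ?_⟩
    rw [← hf, D.readEdges_gaugeState_coboundary hΓ, smul_smul, map_smul]
  have hcode : C.IsCodeState (z • (ψ + bitSign (∑ w, g w) • pauliOp D.logical ψ)) := fun j => by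
    rw [map_smul, D.isCodeState_add_logical hψ _ j]
  rw [hread', foldl_roundProj_pauliOp hcode]
  split_ifs with ha
  swap
  · refine Or.inr ⟨?_, map_zero _⟩
    rintro ⟨x, rfl⟩
    refine ha fun k j => ?_
    rw [symp_vertexX_check, hf]
    exact D.symp_vertexX_check x.2 j
  rw [roundProj_of_eigen (hcode.checkOp_pauliOp _)]
  split_ifs with hfin
  swap
  · refine Or.inr ⟨?_, rfl⟩
    rintro ⟨x, rfl⟩
    refine hfin fun j => ?_
    rw [symp_vertexX_check, hf]
    exact D.symp_vertexX_check x.2 j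
  refine Or.inl ⟨g, f, ?_, z, hz, by rw [map_smul, idealState]⟩
  ext m
  cases m with
  | before k j => exact hb k j
  | gauss k w => exact hd k (Sum.inl w)
  | flux k p => exact hd k (Sum.inr (Sum.inl p))
  | deformed k j => exact hd k (Sum.inr (Sum.inr j))
  | readout e => exact (congrFun hf e).symm
  | after k j => exact ha k j
  | final j => exact hfin j

end GaugingData

/-! ### Moving Pauli errors to the end of the procedure -/

section Push

variable {N K : Type*} [Fintype N] [Fintype K] {n : ℕ}

omit [Fintype N] in
lemma foldl_smul {step : QState N → Fin n → QState N} {z : ℂ}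
    (h : ∀ φ k, step (z • φ) k = z • step φ k) (φ : QState N) :
    Fin.foldl n step (z • φ) = z • Fin.foldl n step φ := by
  induction n with
  | zero => simp
  | succ n ih => rw [Fin.foldl_succ_last, Fin.foldl_succ_last, ih fun _ _ => h _ _, h]

/-- Pauli errors before the rounds of measurements can be moved behind all of them, if the outcomes
are shifted by the syndromes of the accumulated errors. -/
lemma exists_foldl_roundProj_pauliOp (p : K → Pauli N) (z : K → ℂ) (e : Fin n → Pauli N)
    (o : Fin n → K → ZMod 2) (e₀ : Pauli N) :
    ∃ y : ℂ, y ≠ 0 ∧ ∀ φ, Fin.foldl n (fun φ k =>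
        roundProj (fun c => z c • pauliOp (p c)) (o k) (pauliOp (e k) φ)) (pauliOp e₀ φ) =
      y • pauliOp (e₀ + ∑ k, e k) (Fin.foldl n (fun φ k =>
        roundProj (fun c => z c • pauliOp (p c))
          (fun c => o k c + symp (e₀ + ∑ i, if i ≤ k then e i else 0) (p c)) φ) φ) := by
  induction n with
  | zero => exact ⟨1, one_ne_zero, fun φ => by simp⟩
  | succ n ih =>
    obtain ⟨y, hy, h⟩ := ih (fun k => e k.castSucc) (fun k => o k.castSucc)
    obtain ⟨y', hy', h'⟩ := exists_pauliOp_pauliOp (e (Fin.last n)) (e₀ + ∑ k : Fin n, e k.castSucc)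
    refine ⟨y * y', mul_ne_zero hy hy', fun φ => ?_⟩
    have hlt : ∀ k : Fin n, ¬ Fin.last n ≤ k.castSucc := fun k => (Fin.castSucc_lt_last k).not_ge
    have hsum : e (Fin.last n) + (e₀ + ∑ k : Fin n, e k.castSucc) = e₀ + ∑ k, e k := by
      rw [Fin.sum_univ_castSucc]; abel
    have hlast : (∑ i, if i ≤ Fin.last n then e i else 0) = ∑ i, e i :=
      Finset.sum_congr rfl fun i _ => if_pos (Fin.le_last i)
    rw [Fin.foldl_succ_last, Fin.foldl_succ_last, h, map_smul, h', map_smul, map_smul,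
      roundProj_pauliOp, smul_smul, hsum, hlast]
    simp only [Fin.sum_univ_castSucc (fun i => if i ≤ Fin.castSucc _ then e i else 0), hlt,
      if_false, add_zero, Fin.castSucc_le_castSucc_iff]

/-- Pauli errors after the rounds of measurements can be moved behind all of them, if the outcomes
are shifted by the syndromes of the errors accumulated before the respective round. -/
lemma exists_foldl_pauliOp_roundProj (p : K → Pauli N) (z : K → ℂ) (e : Fin n → Pauli N)
    (o : Fin n → K → ZMod 2) (e₀ : Pauli N) :
    ∃ y : ℂ, y ≠ 0 ∧ ∀ φ, Fin.foldl n (fun φ k =>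
        pauliOp (e k) (roundProj (fun c => z c • pauliOp (p c)) (o k) φ)) (pauliOp e₀ φ) =
      y • pauliOp (e₀ + ∑ k, e k) (Fin.foldl n (fun φ k =>
        roundProj (fun c => z c • pauliOp (p c))
          (fun c => o k c + symp (e₀ + ∑ i, if i < k then e i else 0) (p c)) φ) φ) := by
  induction n with
  | zero => exact ⟨1, one_ne_zero, fun φ => by simp⟩
  | succ n ih =>
    obtain ⟨y, hy, h⟩ := ih (fun k => e k.castSucc) (fun k => o k.castSucc)
    obtain ⟨y', hy', h'⟩ := exists_pauliOp_pauliOp (e (Fin.last n)) (e₀ + ∑ k : Fin n, e k.castSucc)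
    refine ⟨y * y', mul_ne_zero hy hy', fun φ => ?_⟩
    have hlt : ∀ k : Fin n, ¬ Fin.last n < k.castSucc := fun k => (Fin.castSucc_lt_last k).le.not_gt
    have hsum : e (Fin.last n) + (e₀ + ∑ k : Fin n, e k.castSucc) = e₀ + ∑ k, e k := by
      rw [Fin.sum_univ_castSucc]; abel
    have hlast : (∑ i, if i < Fin.last n then e i else 0) = ∑ i : Fin n, e i.castSucc := by
      simp [Fin.sum_univ_castSucc, Fin.castSucc_lt_last]
    rw [Fin.foldl_succ_last, Fin.foldl_succ_last, h, map_smul, map_smul, roundProj_pauliOp, h',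
      smul_smul, hsum, hlast]
    simp only [Fin.sum_univ_castSucc (fun i => if i < Fin.castSucc _ then e i else 0), hlt,
      if_false, add_zero, Fin.castSucc_lt_castSucc_iff]

end Push

namespace Fault

variable {Q J W P E : Type*} [DecidableEq E] {a T b : ℕ} (F : Fault Q J W P E a T b)

/-- The accumulated error at the time `t_i`, before the errors at that time. A misinitialized edge
qubit counts as an `X` error. -/
def start : Pauli (Q ⊕ E) :=
  Sum.elim (∑ k, F.before k) fun e => if e ∈ F.init then (1, 0) else 0

/-- The accumulated error at the round `k` of measurements of the deformed code. -/
def duringAt (k : Fin T) : Pauli (Q ⊕ E) :=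
  F.start + ∑ i : Fin T, if i ≤ k then F.during i.castSucc else 0

/-- The accumulated error at the read-out of the edge qubits. -/
def atReadout : Pauli (Q ⊕ E) := F.start + ∑ i, F.during i

/-- The accumulated error on the original qubits after the whole procedure. -/
def total : Pauli Q := (fun q => F.atReadout (Sum.inl q)) + ∑ i, F.after i

end Fault

namespace GaugingData

variable {Q J W P : Type*} [Fintype Q] [DecidableEq Q] [Fintype W] [DecidableEq W]
  {C : StabilizerCode Q J} {Γ : SimpleGraph W} [DecidableRel Γ.Adj] (D : GaugingData C Γ P)
  {a T b : ℕ}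

/-- The syndrome of the Pauli errors and misinitializations of a fault: the measurements whose actual
outcomes they flip. -/
def syndrome (F : Fault Q J W P Γ.edgeSet a T b) : Meas J W P Γ.edgeSet a T b → ZMod 2
  | .before k j => symp (∑ i, if i ≤ k then F.before i else 0) (C.check j)
  | .gauss k w => symp (F.duringAt k) (D.gaussPauli w)
  | .flux k p => symp (F.duringAt k) (D.fluxPauli p)
  | .deformed k j => symp (F.duringAt k) (D.deformedPauli j)
  | .readout e => (F.atReadout (Sum.inr e)).1
  | .after k j => symp ((fun q => F.atReadout (Sum.inl q)) + ∑ i, if i < k then F.after i else 0)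
      (C.check j)
  | .final j => symp F.total (C.check j)

/-- The checks of the deformed code up to their signs. -/
def deformedCheck : W ⊕ P ⊕ J → Pauli (Q ⊕ Γ.edgeSet) :=
  Sum.elim D.gaussPauli (Sum.elim D.fluxPauli D.deformedPauli)

lemma deformedCheckOp_eq : D.deformedCheckOp = fun c =>
    (Sum.elim 1 (Sum.elim 1 fun j => bitSign (C.sign j)) c : ℂ) • pauliOp (D.deformedCheck c) := by
  ext1 (w | p | j)
  · exact (one_smul _ _).symm
  · exact (one_smul _ _).symm
  · rfl

variable [DecidableEq J] [DecidableEq P]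

/-- The measurements whose reported outcomes are flipped by a fault. -/
def flips (F : Fault Q J W P Γ.edgeSet a T b) : Meas J W P Γ.edgeSet a T b → ZMod 2 :=
  (fun m => if m ∈ F.meas then 1 else 0) + D.syndrome F

variable [Fintype J] [Fintype P]

/-- A fault acts on a run by flipping the outcomes `flips F` and applying a Pauli error at the end. -/
lemma exists_run_eq (F : Fault Q J W P Γ.edgeSet a T b)
    (o : Meas J W P Γ.edgeSet a T b → ZMod 2) :
    ∃ z : ℂ, z ≠ 0 ∧ ∀ ψ, D.run F o ψ = z • pauliOp F.total
      (D.run (Fault.none Q J W P Γ.edgeSet a T b) (o + D.flips F) ψ) := by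
  let r : Meas J W P Γ.edgeSet a T b → ZMod 2 := fun m => o m + if m ∈ F.meas then 1 else 0
  have hr : o + D.flips F = r + D.syndrome F := by
    rw [flips, ← add_assoc]; rfl
  obtain ⟨z₁, hz₁, h₁⟩ := exists_foldl_roundProj_pauliOp C.check (fun j => bitSign (C.sign j))
    F.before (fun k j => r (Meas.before k j)) 0
  obtain ⟨z₂, hz₂, h₂⟩ := exists_foldl_roundProj_pauliOp D.deformedCheck
    (Sum.elim 1 (Sum.elim 1 fun j => bitSign (C.sign j))) (fun k : Fin T => F.during k.castSucc)
    (fun k => Sum.elim (fun w => r (Meas.gauss k w))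
        (Sum.elim (fun p => r (Meas.flux k p)) (fun j => r (Meas.deformed k j)))) F.start
  obtain ⟨z₃, hz₃, h₃⟩ := exists_pauliOp_pauliOp (F.during (Fin.last T))
    (F.start + ∑ k : Fin T, F.during k.castSucc)
  obtain ⟨z₄, hz₄, h₄⟩ := exists_readEdges_pauliOp F.atReadout fun e => r (Meas.readout e)
  obtain ⟨z₅, hz₅, h₅⟩ := exists_foldl_pauliOp_roundProj C.check (fun j => bitSign (C.sign j))
    F.after (fun k j => r (Meas.after k j)) fun q => F.atReadout (Sum.inl q)
  have hreadout : F.during (Fin.last T) + (F.start + ∑ k : Fin T, F.during k.castSucc) = F.atReadout := by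
    rw [Fault.atReadout, Fin.sum_univ_castSucc]; abel
  rw [hreadout] at h₃
  have hstart : ∀ φ : QState Q, attachEdges (fun e => if e ∈ F.init then 1 else 0)
      (pauliOp (∑ k, F.before k) φ) = pauliOp F.start (attachEdges (0 : Γ.edgeSet → ZMod 2) φ) := by
    intro φ
    have hsnd : ∀ e, (F.start (Sum.inr e)).2 = 0 := fun e => by
      simp only [Fault.start, Sum.elim_inr]; split_ifs <;> rfl
    have hfst : (fun e => (0 : Γ.edgeSet → ZMod 2) e + (F.start (Sum.inr e)).1) =
        fun e => if e ∈ F.init then 1 else 0 := by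
      ext e
      simp only [Fault.start, Sum.elim_inr, Pi.zero_apply, zero_add]; split_ifs <;> rfl
    rw [pauliOp_attachEdges, hfst]
    simp only [hsnd, mul_zero, zero_mul, bitSign_zero, ZMod.val_zero, pow_zero, mul_one,
      Finset.prod_const_one, one_smul]
    rfl
  have hC : C.checkOp = fun j => bitSign (C.sign j) • pauliOp (C.check j) := rfl
  have hfin := fun φ => roundProj_pauliOp C.check (fun j => bitSign (C.sign j)) F.total
    (fun j => r (Meas.final j)) φ
  have hdef : ∀ k, (fun c => Sum.elim (fun w => r (Meas.gauss k w))
        (Sum.elim (fun p => r (Meas.flux k p)) (fun j => r (Meas.deformed k j))) c +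
      symp (F.start + ∑ i : Fin T, if i ≤ k then F.during i.castSucc else 0) (D.deformedCheck c)) =
      Sum.elim (fun w => (r + D.syndrome F) (Meas.gauss k w))
        (Sum.elim (fun p => (r + D.syndrome F) (Meas.flux k p))
          (fun j => (r + D.syndrome F) (Meas.deformed k j))) := by
    intro k
    ext (w | p | j) <;> rfl
  simp only [hdef, ← D.deformedCheckOp_eq] at h₂
  simp only [zero_add, pauliOp_zero, Module.End.one_apply] at h₁
  rw [← hC] at h₁ h₅ hfin
  refine ⟨z₁ * z₂ * z₃ * z₄ * z₅, by simp [*], fun ψ => ?_⟩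
  have hrun : D.run F o ψ = roundProj C.checkOp (fun j => r (Meas.final j))
      (Fin.foldl b (fun φ k =>
        pauliOp (F.after k) (roundProj C.checkOp (fun j => r (Meas.after k j)) φ))
      (readEdges (fun e => r (Meas.readout e)) (pauliOp (F.during (Fin.last T))
      (Fin.foldl T (fun φ k => roundProj D.deformedCheckOp
        (Sum.elim (fun w => r (Meas.gauss k w))
          (Sum.elim (fun p => r (Meas.flux k p)) (fun j => r (Meas.deformed k j))))
        (pauliOp (F.during k.castSucc) φ))
      (attachEdges (fun e => if e ∈ F.init then 1 else 0) (Fin.foldl a (fun φ k =>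
        roundProj C.checkOp (fun j => r (Meas.before k j)) (pauliOp (F.before k) φ)) ψ)))))) :=
    rfl
  rw [hr, hrun, h₁, attachEdges_smul, hstart, foldl_smul fun _ _ => by rw [map_smul, map_smul], h₂,
    map_smul, map_smul, h₃, readEdges_smul, readEdges_smul, readEdges_smul, h₄]
  simp only [smul_smul]
  rw [foldl_smul fun _ _ => by rw [map_smul, map_smul], h₅, map_smul, map_smul]
  simp only [smul_smul]
  have htot : (fun q => F.atReadout (Sum.inl q)) + ∑ k, F.after k = F.total := rfl
  rw [htot, hfin]
  simp only [run, Fault.none, Finset.notMem_empty, if_false, add_zero, pauliOp_zero,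
    Module.End.one_apply]
  rw [show z₁ * z₂ * z₃ * z₄ * z₅ = z₁ * (z₂ * (z₃ * z₄)) * z₅ by ring]
  rfl

end GaugingData

/-! ### Logical faults -/

/-- A linear functional on binary vectors is the parity on a set of coordinates. -/
lemma exists_sum_ne_zero_of_notMem {M : Type*} [Finite M] {U : Submodule (ZMod 2) (M → ZMod 2)}
    {o : M → ZMod 2} (ho : o ∉ U) :
    ∃ S : Finset M, (∀ u ∈ U, ∑ m ∈ S, u m = 0) ∧ ∑ m ∈ S, o m ≠ 0 := by
  classical
  have := Fintype.ofFinite M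
  obtain ⟨φ, hφ, hker⟩ := Submodule.exists_le_ker_of_notMem ho
  have key : ∀ u, φ u = ∑ m with φ (fun i => if m = i then 1 else 0) ≠ 0, u m := fun u => by
    rw [LinearMap.pi_apply_eq_sum_univ φ u, Finset.sum_filter]
    refine Finset.sum_congr rfl fun m _ => ?_
    split_ifs with h
    · rw [zmod_two_eq_one h, smul_eq_mul, mul_one]
    · rw [not_not.1 h, smul_zero]
  exact ⟨_, fun u hu => (key u).symm.trans (hker hu), key o ▸ hφ⟩

instance {J W P E : Type*} [Finite J] [Finite W] [Finite P] [Finite E] {a T b : ℕ} :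
    Finite (Meas J W P E a T b) := by
  let enc : Meas J W P E a T b →
      (Fin a × J) ⊕ (Fin T × W) ⊕ (Fin T × P) ⊕ (Fin T × J) ⊕ E ⊕ (Fin b × J) ⊕ J
    | .before k j => .inl (k, j)
    | .gauss k w => .inr (.inl (k, w))
    | .flux k p => .inr (.inr (.inl (k, p)))
    | .deformed k j => .inr (.inr (.inr (.inl (k, j))))
    | .readout e => .inr (.inr (.inr (.inr (.inl e))))
    | .after k j => .inr (.inr (.inr (.inr (.inr (.inl (k, j))))))
    | .final j => .inr (.inr (.inr (.inr (.inr (.inr j)))))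
  refine Finite.of_injective enc fun m m' h => ?_
  cases m <;> cases m' <;> simp_all [enc]

namespace GaugingData

variable {Q J W P : Type*} [Fintype Q] [DecidableEq Q] [Fintype W] [DecidableEq W]
  {C : StabilizerCode Q J} {Γ : SimpleGraph W} [DecidableRel Γ.Adj] (D : GaugingData C Γ P)
  {a T b : ℕ}

/-- Both eigenspaces of a logical `X` operator contain code states. -/
lemma exists_isCodeState_logical (s : ZMod 2) :
    ∃ ψ, C.IsCodeState ψ ∧ ψ ≠ 0 ∧ pauliOp D.logical ψ = bitSign s • ψ := by
  obtain ⟨ψ, hψ0, hψ⟩ := C.consistent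
  have hψ : C.IsCodeState ψ := hψ
  have hL := pauliOp_pauliOp_self D.logical
  obtain ⟨t, φ, hφ, hφ0, hLφ⟩ : ∃ t φ, C.IsCodeState φ ∧ φ ≠ 0 ∧
      pauliOp D.logical φ = bitSign t • φ := by
    by_cases h : ψ + bitSign 0 • pauliOp D.logical ψ = 0
    · refine ⟨1, ψ, hψ, hψ0, ?_⟩
      rw [bitSign_zero, one_smul] at h
      rw [bitSign_one, neg_one_smul, eq_neg_of_add_eq_zero_right h]
    · refine ⟨0, _, D.isCodeState_add_logical hψ _, h, ?_⟩
      rw [bitSign_zero, one_smul, one_smul, map_add, hL, add_comm]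
  by_cases hst : s = t
  · exact ⟨φ, hφ, hφ0, hst ▸ hLφ⟩
  obtain ⟨r, hr, hrL⟩ := exists_symp_eq_one D.isLogical.2
  refine ⟨pauliOp r φ, hφ.pauliOp fun j => hr _ (Submodule.subset_span ⟨j, rfl⟩), ?_, ?_⟩
  · intro h
    have := congrArg (pauliOp r) h
    rw [pauliOp_pauliOp_self, map_zero] at this
    exact hφ0 this
  · have hst' : s = 1 + t := by clear hLφ; revert s t; decide
    have hrL : symp r D.logical = 1 := hrL
    rw [pauliOp_comm, hLφ, map_smul, smul_smul, symp_comm, hrL, hst', bitSign_add]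

lemma idealState_ne_zero_iff {g f : W → ZMod 2} {ψ : QState Q} :
    D.idealState g f ψ ≠ 0 ↔ ψ + bitSign (∑ w, g w) • pauliOp D.logical ψ ≠ 0 := by
  refine not_congr ⟨fun h => ?_, fun h => by rw [idealState, h, map_zero]⟩
  rw [← pauliOp_pauliOp_self (D.vertexX f) (_ + _), ← idealState, h, map_zero]

lemma byproduct_record (x : (W → ZMod 2) × (W → ZMod 2)) :
    D.byproduct (D.record (a := a) (T := T) (b := b) x) =
      D.vertexX x.2 + x.2 D.base • D.logical := by
  ext q <;> by_cases h : q ∈ D.supp <;>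
    simp [byproduct, vertexX_apply, logical, h, record, sum_darts_coboundary, add_comm]

lemma result_record [NeZero T] (x : (W → ZMod 2) × (W → ZMod 2)) :
    result (D.record (a := a) (T := T) (b := b) x) = ∑ w, x.1 w := rfl

variable [Fintype J] [DecidableEq J] [Fintype P] [DecidableEq P]

/-- Every outcome `record g f` occurs in some run without faults. -/
lemma exists_possible_record [NeZero T] (hΓ : Γ.Preconnected) (x : (W → ZMod 2) × (W → ZMod 2)) :
    ∃ ψ, C.IsCodeState ψ ∧
      D.Possible (Fault.none Q J W P Γ.edgeSet a T b) ψ (D.record x) := by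
  obtain ⟨ψ, hψ, hψ0, hL⟩ := D.exists_isCodeState_logical (∑ w, x.1 w)
  refine ⟨ψ, hψ, ?_⟩
  rcases D.run_none hΓ hψ (D.record (a := a) (T := T) (b := b) x) with
    ⟨g, f, hgf, z, hz, h⟩ | ⟨h, -⟩
  · have hg : x.1 = g := funext fun w => congrFun hgf (Meas.gauss 0 w)
    rw [Possible, h]
    refine smul_ne_zero hz (D.idealState_ne_zero_iff.2 ?_)
    rw [← hg, hL, smul_smul, bitSign_mul_self, one_smul, ← two_smul ℂ ψ]
    exact smul_ne_zero two_ne_zero hψ0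
  · exact absurd ⟨x, rfl⟩ h

lemma isDetector_iff [NeZero T] (hΓ : Γ.Preconnected)
    {S : Finset (Meas J W P Γ.edgeSet a T b)} :
    D.IsDetector S ↔ ∀ x, ∑ m ∈ S, D.record x m = 0 := by
  constructor
  · intro h x
    obtain ⟨ψ, hψ, hp⟩ := D.exists_possible_record (a := a) (T := T) (b := b) hΓ x
    exact h ψ hψ _ hp
  · intro h ψ hψ o ho
    rcases D.run_none hΓ hψ o with ⟨g, f, rfl, -⟩ | ⟨-, h0⟩
    · exact h _
    · exact absurd h0 ho

/-- The reported record of a fault is possible if and only if the record with the flips removed is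
possible without faults. -/
lemma possible_iff (F : Fault Q J W P Γ.edgeSet a T b) (ψ : QState Q)
    (o : Meas J W P Γ.edgeSet a T b → ZMod 2) :
    D.Possible F ψ o ↔ D.Possible (Fault.none Q J W P Γ.edgeSet a T b) ψ (o + D.flips F) := by
  obtain ⟨z, hz, h⟩ := D.exists_run_eq F o
  rw [Possible, Possible, h]
  refine not_congr ⟨fun h0 => ?_, fun h0 => by rw [h0, map_zero, smul_zero]⟩
  have h0 := (smul_eq_zero.1 h0).resolve_left hz
  rw [← pauliOp_pauliOp_self F.total (D.run _ _ _), h0, map_zero]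

/-- A fault violates no detector if and only if it flips outcomes to another record of a run without
faults. -/
lemma isLogicalFault_iff [NeZero T] (hΓ : Γ.Preconnected) (F : Fault Q J W P Γ.edgeSet a T b) :
    D.IsLogicalFault F ↔ ∃ x, D.record x = D.flips F := by
  have hchar : ∀ o : Meas J W P Γ.edgeSet a T b → ZMod 2, o + o = 0 := ZModModule.add_self
  constructor
  · intro h
    by_contra hF
    obtain ⟨S, hS, hSF⟩ := exists_sum_ne_zero_of_notMem
      (U := LinearMap.range (D.record (a := a) (T := T) (b := b))) (o := D.flips F) hF
    obtain ⟨ψ, hψ, hp⟩ := D.exists_possible_record (a := a) (T := T) (b := b) hΓ 0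
    refine h S ((D.isDetector_iff hΓ).2 fun x => hS _ ⟨x, rfl⟩)
      ⟨ψ, hψ, D.flips F, (D.possible_iff F ψ _).2 ?_, hSF⟩
    rwa [hchar, ← map_zero D.record]
  · rintro ⟨x, hx⟩ S hS ⟨ψ, hψ, o, ho, hSo⟩
    have h1 := hS ψ hψ _ ((D.possible_iff F ψ o).1 ho)
    simp only [Pi.add_apply, Finset.sum_add_distrib, ← hx, (D.isDetector_iff hΓ).1 hS x,
      add_zero] at h1
    exact hSo h1

end GaugingData

namespace GaugingData

variable {Q J W P : Type*} [Fintype Q] [DecidableEq Q] [Fintype W] [DecidableEq W]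
  {C : StabilizerCode Q J} {Γ : SimpleGraph W} [DecidableRel Γ.Adj] (D : GaugingData C Γ P)
  {a T b : ℕ}

/-! ### Spacetime stabilizers -/

/-- The products of checks and `L`, up to phase. -/
def gaugedStabilizers : Submodule (ZMod 2) (Pauli Q) :=
  C.stabilizers ⊔ Submodule.span (ZMod 2) {D.logical}

lemma logical_mem_gaugedStabilizers : D.logical ∈ D.gaugedStabilizers :=
  Submodule.mem_sup_right (Submodule.mem_span_singleton_self _)

lemma exists_pauliOp_eq_smul {p : Pauli Q} (hp : p ∈ D.gaugedStabilizers)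
    {ψ : QState Q} (hψ : C.IsCodeState ψ) (s : ZMod 2) :
    ∃ z : ℂ, pauliOp p (ψ + bitSign s • pauliOp D.logical ψ) =
      z • (ψ + bitSign s • pauliOp D.logical ψ) := by
  have hφ := D.isCodeState_add_logical hψ (bitSign s)
  have hL : pauliOp D.logical (ψ + bitSign s • pauliOp D.logical ψ) =
      bitSign s • (ψ + bitSign s • pauliOp D.logical ψ) := by
    rw [map_add, map_smul, pauliOp_pauliOp_self, smul_add, smul_smul, bitSign_mul_self, one_smul,
      add_comm]
  obtain ⟨q, hq, l, hl, rfl⟩ := Submodule.mem_sup.1 hp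
  obtain ⟨t, rfl⟩ := Submodule.mem_span_singleton.1 hl
  obtain ⟨z, hz⟩ := StabilizerCode.IsCodeState.exists_pauliOp_eq_smul hq
  rcases zmod_two_cases t with rfl | rfl
  · exact ⟨z, by rw [zero_smul, add_zero, hz _ hφ]⟩
  · obtain ⟨y, hy, h⟩ := exists_pauliOp_pauliOp q D.logical
    refine ⟨y⁻¹ * (bitSign s * z), ?_⟩
    rw [one_smul, mul_smul, eq_inv_smul_iff₀ hy, ← h, hL, map_smul, hz _ hφ, smul_smul]

/-- A Pauli operator that acts as a scalar on every code state in the `+1` eigenspace of `L` is a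
product of checks and `L`. -/
lemma mem_gaugedStabilizers_of_forall {p : Pauli Q}
    (h : ∀ ψ, C.IsCodeState ψ → pauliOp D.logical ψ = ψ → ∃ z : ℂ, pauliOp p ψ = z • ψ) :
    p ∈ D.gaugedStabilizers := by
  by_contra hp
  obtain ⟨r, hr, hrp⟩ := exists_symp_eq_one hp
  obtain ⟨ψ, hψ, hψ0, hL⟩ := D.exists_isCodeState_logical 0
  rw [bitSign_zero, one_smul] at hL
  have hrψ : C.IsCodeState (pauliOp r ψ) :=
    hψ.pauliOp fun j => hr _ (Submodule.mem_sup_left (Submodule.subset_span ⟨j, rfl⟩))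
  have hrL : pauliOp D.logical (pauliOp r ψ) = pauliOp r ψ := by
    rw [pauliOp_comm, symp_comm, hr _ D.logical_mem_gaugedStabilizers, bitSign_zero, one_smul, hL]
  obtain ⟨z, hz⟩ := h ψ hψ hL
  obtain ⟨y, hy⟩ := h (ψ + (1 : ℂ) • pauliOp r ψ) (hψ.add_smul hrψ 1)
    (by rw [one_smul, map_add, hL, hrL])
  -- `r` anticommutes with `p`, so `ψ` and `r ψ` are eigenvectors for opposite eigenvalues
  have hanti : pauliOp p (pauliOp r ψ) = -(z • pauliOp r ψ) := by
    rw [pauliOp_comm, symp_comm, hrp, hz, map_smul, bitSign_one, neg_one_smul]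
  rw [one_smul, map_add, hz, hanti, smul_add] at hy
  have hz0 : z ≠ 0 := by
    rintro rfl
    have := congrArg (pauliOp p) hz
    rw [pauliOp_pauliOp_self, zero_smul, map_zero] at this
    exact hψ0 this
  have hy2 := congrArg (pauliOp p) hy
  simp only [map_add, map_neg, map_smul, hz, hanti] at hy2
  have e1 : (z - y) • ψ = (z + y) • pauliOp r ψ := by
    linear_combination (norm := module) hy
  have e2 : (z - y) • ψ = -((z + y) • pauliOp r ψ) := by
    refine smul_right_injective _ hz0 ?_
    simp only
    linear_combination (norm := module) hy2
  have e3 : (2 * (z - y)) • ψ = 0 := by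
    linear_combination (norm := module) e1 + e2
  have hzy : z = y := by
    have := (smul_eq_zero.1 e3).resolve_right hψ0
    linear_combination this / 2
  subst hzy
  rw [sub_self, zero_smul, eq_comm, smul_eq_zero] at e1
  rcases e1 with e1 | e1
  · exact hz0 (by linear_combination e1 / 2)
  · rw [← pauliOp_pauliOp_self r ψ, e1, map_zero] at hψ0
    exact hψ0 rfl

variable [Fintype J] [DecidableEq J] [Fintype P] [DecidableEq P]

/-- A logical fault is a spacetime stabilizer if and only if it flips an even number of the `A_w` and
its Pauli error, corrected according to the flips of the read-out, is a product of checks and `L`. -/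
lemma isSpacetimeStabilizer_iff [NeZero T] (hΓ : Γ.Preconnected)
    {F : Fault Q J W P Γ.edgeSet a T b} {x : (W → ZMod 2) × (W → ZMod 2)}
    (hx : D.record x = D.flips F) :
    D.IsSpacetimeStabilizer F ↔
      ∑ w, x.1 w = 0 ∧ F.total + D.vertexX x.2 ∈ D.gaugedStabilizers := by
  have hchar : ∀ o : Meas J W P Γ.edgeSet a T b → ZMod 2, o + o = 0 := ZModModule.add_self
  constructor
  · rintro ⟨-, h⟩
    -- the stabilizer condition for the reported record `record x = flips F`, which stems from a run
    -- without faults in which all outcomes are `+1`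
    let q : Pauli Q := F.total + D.vertexX x.2 + x.2 D.base • D.logical
    have hq : ∀ ψ, C.IsCodeState ψ → ∃ z : ℂ, pauliOp q (ψ + pauliOp D.logical ψ) =
        z • (ψ + bitSign (∑ w, x.1 w) • pauliOp D.logical ψ) := by
      intro ψ hψ
      obtain ⟨z, hz⟩ := h ψ hψ (D.record x)
      obtain ⟨z₁, hz₁, h₁⟩ := D.exists_run_eq F (D.record x)
      obtain ⟨z₂, hz₂, h₂⟩ := exists_pauliOp_pauliOp
        (D.vertexX x.2 + x.2 D.base • D.logical) F.total
      have hqe : D.vertexX x.2 + x.2 D.base • D.logical + F.total = q := by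
        simp only [q]; abel
      rw [h₁, ← hx, hchar, byproduct_record, map_smul, h₂, hqe, result_record] at hz
      rcases D.run_none (a := a) (T := T) (b := b) hΓ hψ 0 with ⟨g, f, hgf, z₃, hz₃, h₃⟩ | ⟨h₃, -⟩
      · have hg : g = 0 := funext fun w => (congrFun hgf (Meas.gauss 0 w)).symm
        have hf : f = fun _ => f D.base := funext fun w => eq_const_of_coboundary_eq_zero hΓ
          (funext fun e => (congrFun hgf (Meas.readout e)).symm) D.base w
        have hL : pauliOp (D.vertexX f) (ψ + pauliOp D.logical ψ) =
            ψ + pauliOp D.logical ψ := by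
          rw [hf, vertexX_const]
          rcases zmod_two_cases (f D.base) with h0 | h1
          · rw [h0, zero_smul, pauliOp_zero, Module.End.one_apply]
          · rw [h1, one_smul, map_add, pauliOp_pauliOp_self, add_comm]
        have hsum0 : ∑ w, g w = 0 := by simp [hg]
        rw [h₃, idealState, hsum0, bitSign_zero, one_smul, hL, map_smul, smul_smul, smul_smul] at hz
        refine ⟨(z₁ * z₂ * z₃)⁻¹ * z, ?_⟩
        rw [mul_smul, eq_inv_smul_iff₀ (by simp [hz₁, hz₂, hz₃]), hz]
      · exact absurd (zero_mem _) h₃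
    have hsum : ∑ w, x.1 w = 0 := by
      by_contra hne
      obtain ⟨ψ, hψ, hψ0, hL⟩ := D.exists_isCodeState_logical 0
      obtain ⟨z, hz⟩ := hq ψ hψ
      rw [hL, zmod_two_eq_one hne, bitSign_zero, bitSign_one, one_smul, neg_one_smul,
        add_neg_cancel, smul_zero, ← two_smul ℂ ψ, map_smul] at hz
      have := (smul_eq_zero.1 hz).resolve_left two_ne_zero
      rw [← pauliOp_pauliOp_self q ψ, this, map_zero] at hψ0
      exact hψ0 rfl
    refine ⟨hsum, ?_⟩
    have hmem : q ∈ D.gaugedStabilizers := by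
      refine D.mem_gaugedStabilizers_of_forall fun ψ hψ hL => ?_
      obtain ⟨z, hz⟩ := hq ψ hψ
      refine ⟨z, smul_right_injective _ (two_ne_zero (α := ℂ)) ?_⟩
      rw [hL, hsum, bitSign_zero, one_smul, ← two_smul ℂ ψ, map_smul, smul_comm] at hz
      exact hz
    exact (Submodule.add_mem_iff_left _
      (Submodule.smul_mem _ _ D.logical_mem_gaugedStabilizers)).1 hmem
  · rintro ⟨hsum, hmem⟩
    refine ⟨(D.isLogicalFault_iff hΓ F).2 ⟨x, hx⟩, fun ψ hψ o => ?_⟩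
    obtain ⟨z₁, hz₁, h₁⟩ := D.exists_run_eq F o
    rcases D.run_none hΓ hψ (o + D.flips F) with ⟨g, f, hgf, z₃, hz₃, h₃⟩ | ⟨-, h₃⟩
    · have ho : o = D.record ((g, f) + x) := by
        rw [map_add, ← hgf, hx, add_assoc, hchar, add_zero]
      obtain ⟨z₂, hz₂, h₂⟩ := exists_pauliOp_pauliOp F.total (D.vertexX f)
      obtain ⟨z₄, hz₄, h₄⟩ := exists_pauliOp_pauliOp
        (D.vertexX (f + x.2) + (f + x.2) D.base • D.logical) (F.total + D.vertexX f)
      have hq : D.vertexX (f + x.2) + (f + x.2) D.base • D.logical + (F.total + D.vertexX f) ∈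
          D.gaugedStabilizers := by
        have : D.vertexX (f + x.2) + (f + x.2) D.base • D.logical + (F.total + D.vertexX f) =
            F.total + D.vertexX x.2 + (f + x.2) D.base • D.logical := by
          rw [map_add]
          have := ZModModule.add_self (D.vertexX f)
          linear_combination (exp := 1) this
        rw [this]
        exact add_mem hmem (Submodule.smul_mem _ _ D.logical_mem_gaugedStabilizers)
      obtain ⟨z₅, h₅⟩ := D.exists_pauliOp_eq_smul hq hψ (∑ w, g w)
      refine ⟨z₁ * z₃ * z₂ * z₄ * z₅, ?_⟩
      have hres : ∑ w, ((g, f) + x).1 w = ∑ w, g w := by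
        simp [Finset.sum_add_distrib, hsum]
      have hby : D.byproduct o = D.vertexX (f + x.2) + (f + x.2) D.base • D.logical := by
        rw [ho, byproduct_record]; rfl
      rw [h₁, h₃, hby, ho, result_record, hres, idealState]
      simp only [map_smul, h₂, h₄, h₅, smul_smul]
      congr 1
      ring
    · exact ⟨0, by rw [h₁, h₃]; simp⟩

end GaugingData

/-! ### Weights of accumulated errors -/

section Weight

lemma hammingNorm_add_le {ι : Type*} [Fintype ι] {β : Type*} [DecidableEq β] [AddCommGroup β]
    (x y : ι → β) : hammingNorm (x + y) ≤ hammingNorm x + hammingNorm y := by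
  have h := hammingDist_triangle (-x) 0 y
  rwa [hammingDist_eq_hammingNorm, hammingDist_eq_hammingNorm, neg_neg, add_zero,
    hammingDist_zero_left] at h

lemma hammingNorm_sum_le {ι : Type*} [Fintype ι] {β : Type*} [DecidableEq β] [AddCommGroup β]
    {κ : Type*} (s : Finset κ) (x : κ → ι → β) :
    hammingNorm (∑ k ∈ s, x k) ≤ ∑ k ∈ s, hammingNorm (x k) :=
  Finset.le_sum_of_subadditive (fun x : ι → β => hammingNorm x) hammingNorm_zero.le
    hammingNorm_add_le s x

lemma hammingNorm_sum_type {ι κ : Type*} [Fintype ι] [Fintype κ] {β : Type*} [DecidableEq β]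
    [Zero β] (x : ι ⊕ κ → β) :
    hammingNorm x = hammingNorm (fun i => x (Sum.inl i)) + hammingNorm fun k => x (Sum.inr k) := by
  simp [hammingNorm, Finset.card_filter, Fintype.sum_sum_type]

lemma hammingNorm_fst_le {ι : Type*} [Fintype ι] (p : Pauli ι) :
    hammingNorm (fun i => (p i).1) ≤ hammingNorm p :=
  Finset.card_le_card fun i hi => by
    simp only [Finset.mem_filter, Finset.mem_univ, true_and] at hi ⊢
    exact fun h => hi (by rw [h]; rfl)

namespace Fault

variable {Q J W P E : Type*} [Fintype Q] [Fintype E] [DecidableEq E] {a T b : ℕ}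
  (F : Fault Q J W P E a T b)

lemma hammingNorm_start_le :
    hammingNorm F.start ≤ ∑ k, hammingNorm (F.before k) + F.init.card := by
  rw [hammingNorm_sum_type]
  refine add_le_add (hammingNorm_sum_le Finset.univ F.before) (Finset.card_le_card fun e he => ?_)
  by_contra h
  exact (Finset.mem_filter.1 he).2 (if_neg h)

lemma hammingNorm_duringAt_le (k : Fin T) : hammingNorm (F.duringAt k) ≤ F.weight := by
  have h1 := hammingNorm_add_le F.start (∑ i : Fin T, if i ≤ k then F.during i.castSucc else 0)
  have h2 := hammingNorm_sum_le Finset.univ fun i : Fin T =>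
    if i ≤ k then F.during i.castSucc else 0
  have h3 : ∑ i : Fin T, hammingNorm (if i ≤ k then F.during i.castSucc else 0) ≤
      ∑ i, hammingNorm (F.during i) := by
    rw [Fin.sum_univ_castSucc]
    refine le_add_right (Finset.sum_le_sum fun i _ => ?_)
    split_ifs <;> simp
  have h4 := F.hammingNorm_start_le
  rw [duringAt, weight]
  omega

lemma hammingNorm_total_add_le :
    hammingNorm F.total + hammingNorm (fun e => (F.atReadout (Sum.inr e)).1) + F.meas.card ≤
      F.weight := by
  have h1 := hammingNorm_add_le F.start (∑ i, F.during i)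
  have h2 := hammingNorm_sum_le Finset.univ F.during
  have h3 := hammingNorm_sum_le Finset.univ F.after
  have h4 := F.hammingNorm_start_le
  have h5 := hammingNorm_add_le (fun q => F.atReadout (Sum.inl q)) (∑ i, F.after i)
  have h6 := hammingNorm_sum_type F.atReadout
  have h7 := hammingNorm_fst_le fun e => F.atReadout (Sum.inr e)
  rw [← atReadout] at h1
  rw [← total] at h5
  rw [weight]
  omega

end Fault

end Weight

/-! ### The lower bound on the weight -/

/-- A fault that misreports fewer measurements than there are rounds of measurements of the deformed
code leaves one of these rounds without misreported measurements. -/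
lemma Fault.exists_round {Q J W P E : Type*} {a T b : ℕ} (F : Fault Q J W P E a T b)
    (h : F.meas.card < T) : ∃ k : Fin T, (∀ w, Meas.gauss k w ∉ F.meas) ∧
      (∀ p, Meas.flux k p ∉ F.meas) ∧ ∀ j, Meas.deformed k j ∉ F.meas := by
  let round : Meas J W P E a T b → Option (Fin T)
    | .gauss k _ => some k
    | .flux k _ => some k
    | .deformed k _ => some k
    | _ => Option.none
  by_contra! hk
  have hm : ∀ k : Fin T, ∃ m ∈ F.meas, round m = some k := by
    intro k
    by_contra! hm
    obtain ⟨j, hj⟩ := hk k (fun w hw => hm _ hw rfl) (fun p hp => hm _ hp rfl)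
    exact hm _ hj rfl
  choose m hm hmk using hm
  have hcard : (Finset.univ : Finset (Fin T)).card ≤ F.meas.card :=
    Finset.card_le_card_of_injOn m (fun k _ => hm k) fun k _ k' _ hkk => by
      simpa [hmk] using congrArg round hkk
  rw [Finset.card_univ, Fintype.card_fin] at hcard
  omega

namespace GaugingData

section Distance

variable {Q J W P : Type*} [Fintype Q] [DecidableEq Q] [Fintype W] [DecidableEq W]
  {C : StabilizerCode Q J} {Γ : SimpleGraph W} [DecidableRel Γ.Adj] (D : GaugingData C Γ P)
  {a T b : ℕ}

/-- Cleaning the edge part of an error by the operators `A_w` does not increase its weight. -/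
lemma le_hammingNorm_add {d : ℕ} (hd : C.HasDistance d) {f : W → ZMod 2}
    (hexp : ∃ t : ZMod 2,
      hammingNorm (D.vertexX (f + fun _ => t)) ≤ hammingNorm (coboundary Γ f))
    {p : Pauli Q} (hp : ∀ t : ZMod 2, C.IsLogical (p + D.vertexX f + t • D.logical)) :
    d ≤ hammingNorm p + hammingNorm (coboundary Γ f) := by
  obtain ⟨t, ht⟩ := hexp
  have h := hd.2 ⟨_, hp t, rfl⟩
  rw [add_assoc, ← vertexX_const, ← map_add] at h
  exact h.trans ((hammingNorm_add_le _ _).trans (by gcongr))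

lemma symp_vertexX_logical (f : W → ZMod 2) : symp (D.vertexX f) D.logical = 0 := by
  rw [symp_vertexX]
  exact Finset.sum_eq_zero fun q _ => by simp [logical]

/-- The product of all the `A_w` is `L`. -/
lemma sum_symp_gaussPauli (p : Pauli (Q ⊕ Γ.edgeSet)) :
    ∑ w, symp p (D.gaussPauli w) = symp (fun q => p (Sum.inl q)) D.logical := by
  have hsum : ∑ w, (Pi.single w 1 : W → ZMod 2) = fun _ => 1 :=
    Finset.univ_sum_single (fun _ : W => (1 : ZMod 2))
  have hL : ∑ w, D.vertexX (Pi.single w 1) = D.logical := by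
    rw [← map_sum, hsum, vertexX_const, one_smul]
  have hE : ∑ w, coboundary Γ (Pi.single w 1) = 0 := by
    rw [← map_sum, hsum, coboundary_const]
  simp only [symp_sum, gaussPauli_inl, gaussPauli_inr, mul_zero, zero_add, Finset.sum_add_distrib]
  rw [Finset.sum_comm]
  have hE' : ∀ e, ∑ w, coboundary Γ (Pi.single w 1) e = 0 := fun e => by
    rw [← Finset.sum_apply, hE]; rfl
  simp only [← Finset.mul_sum, hE', mul_zero, Finset.sum_const_zero, add_zero]
  rw [← hL, symp_comm, ← sympLin_apply, map_sum]
  exact Finset.sum_congr rfl fun w _ => symp_comm _ _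

variable [DecidableEq J] [DecidableEq P]

/-- A fault that flips the result has weight at least `d`: in a round without misreported
measurements the accumulated error is a logical operator of the deformed code that anticommutes
with `L`. -/
lemma le_weight_of_sum_eq_one {d : ℕ} (hd : C.HasDistance d) (hT : d ≤ T)
    (hexp : ∀ f, ∃ t : ZMod 2,
      hammingNorm (D.vertexX (f + fun _ => t)) ≤ hammingNorm (coboundary Γ f))
    {F : Fault Q J W P Γ.edgeSet a T b} {x : (W → ZMod 2) × (W → ZMod 2)}
    (hx : D.record x = D.flips F) (h1 : ∑ w, x.1 w = 1) : d ≤ F.weight := by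
  by_cases hm : T ≤ F.meas.card
  · rw [Fault.weight]; omega
  obtain ⟨k, hg, hfl, hde⟩ := F.exists_round (not_le.1 hm)
  have hflip : ∀ m ∉ F.meas, D.syndrome F m = D.record x m := fun m hm => by
    simp [hx, flips, hm]
  have hflux : ∀ p, ∑ e, (F.duringAt k (Sum.inr e)).1 * D.cycle p e = 0 := by
    intro p
    have : symp (F.duringAt k) (D.fluxPauli p) = 0 := hflip _ (hfl p)
    simpa [symp_sum, symp, fluxPauli] using this
  obtain ⟨f, hf⟩ := exists_coboundary_eq D.span_cycle hflux
  let u : Pauli Q := fun q => F.duringAt k (Sum.inl q)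
  have hcheck : ∀ j, symp (u + D.vertexX f) (C.check j) = 0 := by
    intro j
    have : symp (F.duringAt k) (D.deformedPauli j) = 0 := hflip _ (hde j)
    rw [symp_add_left, symp_vertexX_check, hf]
    simpa [symp_sum, deformedPauli] using this
  have hL : symp u D.logical = 1 := by
    rw [← h1, ← D.sum_symp_gaussPauli]
    exact Finset.sum_congr rfl fun w _ => hflip _ (hg w)
  have hLL : symp D.logical D.logical = 0 := by
    simpa [vertexX_const] using D.symp_vertexX_logical fun _ => 1
  have hlog : ∀ t : ZMod 2, C.IsLogical (u + D.vertexX f + t • D.logical) := by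
    intro t
    refine ⟨fun j => ?_, fun hmem => ?_⟩
    · rw [symp_add_left, hcheck, zero_add, ← sympLin_apply, map_smul, sympLin_apply]
      have : symp D.logical (C.check j) = 0 := D.isLogical.1 j
      rw [this, smul_zero]
    · have h0 := StabilizerCode.symp_eq_zero_of_mem (p := D.logical) D.isLogical.1 hmem
      rw [symp_comm, symp_add_left, symp_add_left, symp_vertexX_logical, hL, ← sympLin_apply,
        map_smul, sympLin_apply, hLL] at h0
      simp at h0
  have hle := D.le_hammingNorm_add hd (hexp f) hlog
  rw [hf] at hle
  have h2 := hammingNorm_fst_le fun e => F.duringAt k (Sum.inr e)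
  have h3 := hammingNorm_sum_type (F.duringAt k)
  have h4 := F.hammingNorm_duringAt_le k
  simp only [u] at hle
  omega

/-- A fault with a nontrivial corrected Pauli error has weight at least `d`. -/
lemma le_weight_of_notMem {d : ℕ} (hd : C.HasDistance d)
    (hexp : ∀ f, ∃ t : ZMod 2,
      hammingNorm (D.vertexX (f + fun _ => t)) ≤ hammingNorm (coboundary Γ f))
    {F : Fault Q J W P Γ.edgeSet a T b} {x : (W → ZMod 2) × (W → ZMod 2)}
    (hx : D.record x = D.flips F)
    (h : F.total + D.vertexX x.2 ∉ D.gaugedStabilizers) : d ≤ F.weight := by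
  have hlog : ∀ t : ZMod 2, C.IsLogical (F.total + D.vertexX x.2 + t • D.logical) := by
    intro t
    refine ⟨fun j => ?_, fun hmem => h ?_⟩
    · have hfin : symp (D.vertexX x.2) (C.check j) = symp F.total (C.check j) := by
        have := congrFun hx (Meas.final j)
        rw [flips, Pi.add_apply, if_neg (F.final_perfect j), zero_add] at this
        exact this
      have : symp D.logical (C.check j) = 0 := D.isLogical.1 j
      rw [symp_add_left, symp_add_left, ← sympLin_apply (t • _), map_smul, sympLin_apply, this,
        hfin, CharTwo.add_self_eq_zero, smul_zero, add_zero]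
    · exact (Submodule.add_mem_iff_left _
        (Submodule.smul_mem _ t D.logical_mem_gaugedStabilizers)).1 (Submodule.mem_sup_left hmem)
  have hle := D.le_hammingNorm_add hd (hexp x.2) hlog
  -- the edges of the coboundary are those whose read-out is flipped, so each of them costs a
  -- misreported read-out or an `X` error
  have hread : coboundary Γ x.2 =
      (fun e => if Meas.readout e ∈ F.meas then 1 else 0) + fun e => (F.atReadout (Sum.inr e)).1 :=
    funext fun e => congrFun hx (Meas.readout e)
  have h1 := hammingNorm_add_le (fun e => if Meas.readout e ∈ F.meas then (1 : ZMod 2) else 0)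
    fun e => (F.atReadout (Sum.inr e)).1
  rw [← hread] at h1
  have h2 : hammingNorm (fun e => if Meas.readout e ∈ F.meas then (1 : ZMod 2) else 0) ≤
      F.meas.card := by
    refine Finset.card_le_card_of_injOn Meas.readout (fun e he => ?_) fun e _ e' _ hee => by
      simpa using hee
    simpa using he
  have h3 := F.hammingNorm_total_add_le
  omega

variable [Fintype J] [Fintype P]

lemma le_faultDistance [NeZero T] (hΓ : Γ.Preconnected) {d : ℕ} (hd : C.HasDistance d)
    (hT : d ≤ T) (hexp : ∀ f, ∃ t : ZMod 2,
      hammingNorm (D.vertexX (f + fun _ => t)) ≤ hammingNorm (coboundary Γ f)) :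
    (d : ℕ∞) ≤ D.faultDistance a T b := by
  refine le_iInf fun F => le_iInf fun hF => le_iInf fun hns => ?_
  rw [Nat.cast_le]
  obtain ⟨x, hx⟩ := (D.isLogicalFault_iff hΓ F).1 hF
  rw [D.isSpacetimeStabilizer_iff hΓ hx, not_and_or] at hns
  rcases hns with hns | hns
  · exact D.le_weight_of_sum_eq_one hd hT hexp hx (zmod_two_eq_one hns)
  · exact D.le_weight_of_notMem hd hexp hx hns

/-! ### Faults of minimal weight -/

lemma faultDistance_le_weight [NeZero T] (hΓ : Γ.Preconnected)
    {F : Fault Q J W P Γ.edgeSet a T b} {x : (W → ZMod 2) × (W → ZMod 2)}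
    (hx : D.record x = D.flips F)
    (h : ∑ w, x.1 w ≠ 0 ∨ F.total + D.vertexX x.2 ∉ D.gaugedStabilizers) :
    D.faultDistance a T b ≤ F.weight := by
  refine iInf_le_of_le F (iInf_le_of_le ((D.isLogicalFault_iff hΓ F).2 ⟨x, hx⟩)
    (iInf_le_of_le ?_ le_rfl))
  rwa [D.isSpacetimeStabilizer_iff hΓ hx, not_and_or]

/-- Misreporting one of the `A_w` in all rounds is not detected, but flips the result. -/
lemma faultDistance_le_rounds [NeZero T] (hΓ : Γ.Preconnected) :
    D.faultDistance a T b ≤ T := by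
  obtain ⟨F, hbef, hdur, haft, hinit, hmeas⟩ : ∃ F : Fault Q J W P Γ.edgeSet a T b,
      F.before = 0 ∧ F.during = 0 ∧ F.after = 0 ∧ F.init = ∅ ∧
        F.meas = Finset.univ.image fun k => Meas.gauss k D.base :=
    ⟨⟨0, 0, 0, ∅, Finset.univ.image fun k => Meas.gauss k D.base, by simp⟩,
      rfl, rfl, rfl, rfl, rfl⟩
  have hstart : F.start = 0 := by
    ext (q | e) <;> simp [Fault.start, hbef, hinit]
  have hat : ∀ k, F.duringAt k = 0 := fun k => by simp [Fault.duringAt, hstart, hdur]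
  have hreadout : F.atReadout = 0 := by simp [Fault.atReadout, hstart, hdur]
  have hreadout' : (fun q => F.atReadout (Sum.inl q)) = (0 : Pauli Q) := by rw [hreadout]; rfl
  have htot : F.total = 0 := by simp [Fault.total, hreadout', haft]
  have hx : D.record (Pi.single D.base 1, 0) = D.flips F := by
    have h0 : (fun _ : Q => (0 : ZMod 2 × ZMod 2)) = 0 := rfl
    ext m
    cases m <;> simp [record, flips, syndrome, hat, hreadout, h0, htot, hbef, haft, hmeas,
      symp_zero_left, Pi.single_apply, eq_comm]
  have hw : F.weight = T := by
    have : F.meas.card = T := by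
      rw [hmeas, Finset.card_image_of_injective _ fun k k' h => by simpa using h, Finset.card_univ,
        Fintype.card_fin]
    simp [Fault.weight, this, hbef, hdur, haft, hinit]
  exact (D.faultDistance_le_weight hΓ hx (Or.inl (by simp))).trans_eq (by rw [hw])

/-- A logical operator applied right before the read-out of the edge qubits is not detected. -/
lemma faultDistance_le_hammingNorm [NeZero T] (hΓ : Γ.Preconnected) {p : Pauli Q}
    (hp : ∀ j, symp p (C.check j) = 0) (hpL : p ∉ D.gaugedStabilizers) :
    D.faultDistance a T b ≤ hammingNorm p := by
  obtain ⟨F, hbef, hdur, haft, hinit, hmeas⟩ : ∃ F : Fault Q J W P Γ.edgeSet a T b,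
      F.before = 0 ∧ F.during = Pi.single (Fin.last T) (Sum.elim p 0) ∧ F.after = 0 ∧
        F.init = ∅ ∧ F.meas = ∅ :=
    ⟨⟨0, Pi.single (Fin.last T) (Sum.elim p 0), 0, ∅, ∅, by simp⟩, rfl, rfl, rfl, rfl, rfl⟩
  have hstart : F.start = 0 := by
    ext (q | e) <;> simp [Fault.start, hbef, hinit]
  have hat : ∀ k, F.duringAt k = 0 := fun k => by
    simp [Fault.duringAt, hstart, hdur, (Fin.castSucc_lt_last _).ne]
  have hreadout : F.atReadout = Sum.elim p 0 := by
    rw [Fault.atReadout, hstart, zero_add, hdur]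
    exact (Finset.sum_pi_single' _ _ _).trans (if_pos (Finset.mem_univ _))
  have hreadout' : (fun q => F.atReadout (Sum.inl q)) = p := by rw [hreadout]; rfl
  have htot : F.total = p := by simp [Fault.total, hreadout', haft]
  have hx : D.record 0 = D.flips F := by
    rw [map_zero]
    ext m
    cases m <;> simp [flips, syndrome, hat, hreadout, htot, hbef, haft, hmeas,
      symp_zero_left, hp]
  have hw : F.weight = hammingNorm p := by
    have : ∑ k, hammingNorm (F.during k) = hammingNorm p := by
      rw [hdur, Finset.sum_eq_single (Fin.last T)]
      · rw [Pi.single_eq_same, hammingNorm_sum_type]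
        change hammingNorm p + hammingNorm 0 = hammingNorm p
        rw [hammingNorm_zero, add_zero]
      · intro k _ hk
        rw [Pi.single_eq_of_ne hk, hammingNorm_zero]
      · simp
    simp [Fault.weight, this, hbef, haft, hinit, hmeas]
  rw [← hw]
  refine D.faultDistance_le_weight hΓ hx (Or.inr ?_)
  simpa [htot] using hpL

end Distance

/-- In a graph with layers of Cheeger constant at least `1`, the product of the `A_w` over a set of
vertices or over its complement acts on at most as many of the original qubits as edges. -/
lemma exists_hammingNorm_vertexX_le {Q J V P : Type*} [Fintype Q] [DecidableEq Q]
    [Fintype V] [DecidableEq V] {C : StabilizerCode Q J} {G : SimpleGraph V} [DecidableRel G.Adj]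
    (hh : 1 ≤ cheeger G) {R : ℕ} {Γ : SimpleGraph (V × Fin (R + 1))} [DecidableRel Γ.Adj]
    (hΓ : IsLayered G Γ) (D : GaugingData C Γ P) (hvert : ∀ q, (D.vert q).2 = 0)
    (f : V × Fin (R + 1) → ZMod 2) :
    ∃ t : ZMod 2, hammingNorm (D.vertexX (f + fun _ => t)) ≤ hammingNorm (coboundary Γ f) := by
  obtain ⟨t, ht⟩ := exists_card_le_hammingNorm_coboundary hh hΓ f
  refine ⟨t, le_trans ?_ ht⟩
  rw [hammingNorm, ← Finset.card_attach]
  have hs : ∀ q ∈ ({q | D.vertexX (f + fun _ => t) q ≠ 0} : Finset Q), ∃ h : q ∈ D.supp,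
      f (D.vert ⟨q, h⟩) + t ≠ 0 := by
    intro q hq
    by_cases h : q ∈ D.supp
    · refine ⟨h, fun h0 => ?_⟩
      simp [vertexX_apply, h, h0] at hq
    · simp [vertexX_apply, h] at hq
  refine Finset.card_le_card_of_injOn (fun q => (D.vert ⟨q.1, (hs q.1 q.2).1⟩).1) ?_ ?_
  · intro q _
    have h := (hs q.1 q.2).2
    rw [← Prod.mk.eta (p := D.vert _), hvert] at h
    simpa using h
  · intro q _ q' _ h
    have := D.vert.injective (Prod.ext h ((hvert _).trans (hvert _).symm))
    exact Subtype.ext (by simpa using this)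

end GaugingData

end Gauging

end

theorem mainTheorem3 {Q J V P : Type*} [Fintype Q] [DecidableEq Q] [Fintype J] [DecidableEq J]
    [Fintype V] [DecidableEq V] [Fintype P] [DecidableEq P]
    -- the original code and its distance
    (C : Gauging.StabilizerCode Q J) (d : ℕ) (hd : C.HasDistance d)
    -- the expanding graph and the graph used for gauging, with the support of `L` in its layer `0`
    (G : SimpleGraph V) [DecidableRel G.Adj] (hG : G.Connected) (hh : 1 ≤ Gauging.cheeger G)
    {R : ℕ} (Γ : SimpleGraph (V × Fin (R + 1))) [DecidableRel Γ.Adj] (hΓ : Gauging.IsLayered G Γ)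
    (D : Gauging.GaugingData C Γ P) (hvert : ∀ q, (D.vert q).2 = 0)
    -- the numbers of rounds, where `T = t_o - t_i`
    (a T b : ℕ) [NeZero T] (ha : d ≤ a + 1) (hT : d ≤ T) (hb : d ≤ b + 1) :
    (d : ℕ∞) ≤ D.faultDistance a T b ∧
      ((T = d ∨ ∃ p : Gauging.Pauli Q, C.IsLogical p ∧ hammingNorm p = d ∧
          p ∉ C.stabilizers ⊔ Submodule.span (ZMod 2) {D.logical}) →
        D.faultDistance a T b = d) := by
  have hconn := hΓ.preconnected hG
  have hle : (d : ℕ∞) ≤ D.faultDistance a T b :=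
    D.le_faultDistance hconn hd hT (D.exists_hammingNorm_vertexX_le hh hΓ hvert)
  refine ⟨hle, fun h => le_antisymm ?_ hle⟩
  rcases h with rfl | ⟨p, hp, rfl, hpL⟩
  · exact D.faultDistance_le_rounds hconn
  · exact D.faultDistance_le_hammingNorm hconn hp.1 hpL
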